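/- Let $K$ be a field with $\operatorname{char} K \neq 2$ and algebraic closure $\overline K$, let $f(z)=z^2-1$, and let $x_0\in K$ with $x_0\neq 0,-1$. For $n\ge 0$ let $f^{-n}(x_0)=\{z\in\overline K: f^n(z)=x_0\}$, $K_n=K(f^{-n}(x_0))$, $K_\infty=\bigcup_n K_n$, $G_n=\operatorname{Gal}(K_n/K)$ and $G_\infty=\operatorname{Gal}(K_\infty/K)$. Let $T_\infty$ be the infinite binary rooted tree whose level-$m$ nodes are the words $s_1\cdots s_m$ in the letters $a,b$, the nodes directly above $x$ being $xa$ and $xb$; the root is the empty word. Let $T_n$ be its subtree formed by the levels $0,\dots,n$. Fix primitive $2^m$-th roots of unity $\zeta_{2^m}\in\overline K$ ($m\ge 0$) with $\zeta_{2^{m+1}}^2=\zeta_{2^m}$, and fix a labeling of the tree of preimages of $x_0$, that is, a map $w\mapsto[w]\in\overline K$ on the nodes of $T_\infty$ which maps the level-$m$ nodes bijectively onto $f^{-m}(x_0)$ for every $m\geq 0$ and satisfies $f([wa])=f([wb])=[w]$ for every node $w$. Assume that for every node $y$ and every $i\ge 0$ $$\Bigg(\prod_{s_1,\ldots,s_i\in\{a,b\}}[y\,a\,s_1\,a\,s_2\,a\cdots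 s_i\,a]\Bigg)\Bigg(\prod_{s_1,\ldots,s_i\in\{a,b\}}[y\,b\,s_1\,a\,s_2\,a\cdots s_i\,a]\Bigg)^{-1}=\zeta_{2^{i+1}}.$$ Through this labeling, $G_n$ acts on $T_n$ and $G_\infty$ acts on $T_\infty$. For $\sigma\in\operatorname{Aut}(T_\infty)$ and a node $x$, let $\operatorname{Par}(\sigma,x)=0$ if $\sigma(xa)=\sigma(x)a$, and $\operatorname{Par}(\sigma,x)=1$ if $\sigma(xa)=\sigma(x)b$, and define $$Q(\sigma,x)=\sum_{i\ge 0}2^i\sum_{s_1,\ldots,s_i\in\{a,b\}}\operatorname{Par}(\sigma,x\,a\,s_1\,a\,s_2\cdots a\,s_i)\in\mathbb Z_2,$$ $$P(\sigma,x)=(-1)^{\operatorname{Par}(\sigma,x)}+2\sum_{t\in\{a,b\}}Q(\sigma,xbt)-2\sum_{t\in\{a,b\}}Q(\sigma,xat)\in\mathbb Z_2^\times.$$ The arithmetic basilica group $M_\infty$ is the group of all $\sigma\in\operatorname{Aut}(T_\infty)$ such that $P(\sigma,x)$ has the same value for all nodes $x$ of $T_\infty$. For $n\geq 1$, $M_n$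 is the group of all $\tau\in\operatorname{Aut}(T_n)$ such that, for every $0\le m\le n$ and every node $x$ at level $m$, $$P(\tilde\tau,x)\equiv P(\tilde\tau,\text{root})\pmod{2^{\lfloor (n-m+1)/2\rfloor}},$$ where $\tilde\tau\in\operatorname{Aut}(T_\infty)$ is any extension of $\tau$ (the condition does not depend on its choice). Then the following are equivalent: 1. $[K(\sqrt{-x_0},\sqrt{1+x_0},\zeta_8):K]=16$; 2. $[K_5:K]=2^{25}$; 3. $G_5\cong M_5$; 4. $G_n\cong M_n$ for all $n\ge 1$; 5. $G_\infty\cong M_\infty$. In (3)–(5), $\cong$ means that there is a group isomorphism which is equivariant for the actions on the nodes of the tree: $g([w])=[\varphi(g)(w)]$ for all group elements $g$ and all nodes $w$. -/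

import Mathlib

namespace Basilica

/-! ### The labeled binary rooted tree

Nodes are identified with their labels, the words in two letters `a`, `b`, read from the root
upwards; the two nodes directly above `x` are `x ++ [a]` and `x ++ [b]`. -/

abbrev a : Bool := false

abbrev b : Bool := true

/-- The nodes of the infinite binary tree `T_∞`. The root is the empty word. -/
abbrev Word : Type := List Bool

/-- The nodes of the tree `T_n`, which extends `n` levels above the root. -/
abbrev WordLE (n : ℕ) : Type := {w : Word // w.length ≤ n}

/-- The parent of a node of `T_n` (the root is its own parent by convention). -/
def WordLE.parent {n : ℕ} (w : WordLE n) : WordLE n :=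
  ⟨w.1.dropLast, by have := w.2; rw [List.length_dropLast]; omega⟩

/-- `Aut(T_∞)`: the permutations of the nodes which preserve levels and parents. -/
def autInf : Subgroup (Equiv.Perm Word) where
  carrier := {σ | ∀ w, (σ w).length = w.length ∧ σ w.dropLast = (σ w).dropLast}
  mul_mem' := by
    intro σ τ hσ hτ w
    simp only [Equiv.Perm.mul_apply]
    exact ⟨(hσ _).1.trans (hτ _).1, by rw [(hτ w).2, (hσ _).2]⟩
  one_mem' := by intro w; simp
  inv_mem' := by
    intro σ hσ w
    have h := hσ (σ⁻¹ w)
    rw [show σ (σ⁻¹ w) = w from σ.apply_symm_apply w] at h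
    refine ⟨h.1.symm, ?_⟩
    rw [← h.2]
    exact σ.symm_apply_apply _

/-- `Aut(T_n)`: the permutations of the nodes which preserve levels and parents. -/
def autFin (n : ℕ) : Subgroup (Equiv.Perm (WordLE n)) where
  carrier := {σ | ∀ w, (σ w).1.length = w.1.length ∧ σ w.parent = (σ w).parent}
  mul_mem' := by
    intro σ τ hσ hτ w
    simp only [Equiv.Perm.mul_apply]
    exact ⟨(hσ _).1.trans (hτ _).1, by rw [(hτ w).2, (hσ _).2]⟩
  one_mem' := by intro w; simp
  inv_mem' := by
    intro σ hσ w
    have h := hσ (σ⁻¹ w)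
    rw [show σ (σ⁻¹ w) = w from σ.apply_symm_apply w] at h
    refine ⟨h.1.symm, ?_⟩
    rw [← h.2]
    exact σ.symm_apply_apply _

/-- The parity of `σ` at `x`: it is `0` if `σ(xa) = σ(x)a` (and hence `σ(xb) = σ(x)b`), and `1`
if `σ(xa) = σ(x)b` (and hence `σ(xb) = σ(x)a`); see `apply_concat`. -/
def par (σ : autInf) (x : Word) : ℕ :=
  if σ.1 (x ++ [a]) = σ.1 x ++ [a] then 0 else 1

/-- The word `a s₁ a s₂ ⋯ a sᵢ`. -/
def zig {i : ℕ} (s : Fin i → Bool) : Word := (List.ofFn s).flatMap fun t => [a, t]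

/-- The word `s₁ a s₂ a ⋯ sᵢ a`. -/
def zag {i : ℕ} (s : Fin i → Bool) : Word := (List.ofFn s).flatMap fun t => [t, a]

/-- `Q(σ,x) = ∑_{i ≥ 0} 2^i ∑_{s₁,…,sᵢ} Par(σ, x a s₁ a s₂ ⋯ a sᵢ)`, a convergent series in the
`2`-adic integers; see `summable_Q`. -/
noncomputable def Q (σ : autInf) (x : Word) : ℤ_[2] :=
  ∑' i : ℕ, 2 ^ i * ∑ s : Fin i → Bool, (par σ (x ++ zig s) : ℤ_[2])

/-- `P(σ,x) = (-1)^{Par(σ,x)} + 2 ∑_t Q(σ,xbt) - 2 ∑_t Q(σ,xat)`. -/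
noncomputable def P (σ : autInf) (x : Word) : ℤ_[2] :=
  (-1) ^ par σ x + 2 * ∑ t : Bool, Q σ (x ++ [b, t]) - 2 * ∑ t : Bool, Q σ (x ++ [a, t])

/-- `P(σ,x) ≡ P(σ,x₀) (mod 2^j)`, `j = ⌊(n-m+1)/2⌋`, for all nodes `x` at levels `m ≤ n`. -/
def CongrUpTo (n : ℕ) (σ : autInf) : Prop :=
  ∀ x : Word, x.length ≤ n → (2 : ℤ_[2]) ^ ((n - x.length + 1) / 2) ∣ P σ x - P σ []

/-- `σ ∈ Aut(T_∞)` is an extension of `τ ∈ Aut(T_n)`. -/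
def Extends {n : ℕ} (σ : autInf) (τ : autFin n) : Prop :=
  ∀ w : WordLE n, σ.1 w.1 = (τ.1 w).1

/-! ### Facts showing that the arithmetic basilica groups are groups -/

lemma summable_Q (σ : autInf) (x : Word) :
    Summable fun i : ℕ => (2 : ℤ_[2]) ^ i * ∑ s : Fin i → Bool, (par σ (x ++ zig s) : ℤ_[2]) := by
  refine Summable.of_norm_bounded (g := fun i : ℕ => ((1 : ℝ) / 2) ^ i)
    (summable_geometric_of_lt_one (by norm_num) (by norm_num)) fun i => ?_
  rw [norm_mul, norm_pow]
  have h2 : ‖(2 : ℤ_[2])‖ = 1 / 2 := by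
    have := PadicInt.norm_p (p := 2)
    simpa using this
  rw [h2]
  exact mul_le_of_le_one_right (by positivity) (PadicInt.norm_le_one _)

lemma Q_next (σ : autInf) (x : Word) :
    Q σ x = par σ x + 2 * ∑ t : Bool, Q σ (x ++ [a, t]) := by
  unfold Q
  rw [(summable_Q σ x).tsum_eq_zero_add]
  congr 1
  · simp [zig]
  · rw [Fintype.sum_bool, ← (summable_Q σ _).tsum_add (summable_Q σ _),
      ← ((summable_Q σ _).add (summable_Q σ _)).tsum_mul_left]
    refine tsum_congr fun i => ?_
    have : (∑ s : Fin (i + 1) → Bool, (par σ (x ++ zig s) : ℤ_[2])) =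
        ∑ p : Bool × (Fin i → Bool), (par σ ((x ++ [a, p.1]) ++ zig p.2) : ℤ_[2]) := by
      refine (Fintype.sum_equiv (Fin.consEquiv fun _ => Bool) _ _ fun p => ?_).symm
      simp [zig, Fin.consEquiv, List.ofFn_succ]
    rw [this, Fintype.sum_prod_type, Fintype.sum_bool]
    ring

lemma length_apply (σ : autInf) (w : Word) : (σ.1 w).length = w.length := (σ.2 w).1

lemma apply_concat_eq (σ : autInf) (x : Word) (c : Bool) :
    ∃ d, σ.1 (x ++ [c]) = σ.1 x ++ [d] := by
  have h := (σ.2 (x ++ [c])).2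
  have hl := length_apply σ (x ++ [c])
  have hne : σ.1 (x ++ [c]) ≠ [] := by
    intro h0
    rw [h0] at hl
    simp at hl
  rw [List.dropLast_concat] at h
  exact ⟨_, by rw [h]; exact (List.dropLast_append_getLast hne).symm⟩

lemma par_eq (σ : autInf) (x : Word) : par σ x = 0 ∨ par σ x = 1 := by
  unfold par; split <;> simp

/-- The word `σ(xc)` is `σ(x)c` if the parity is `0`, and `σ(x)c'`, `c' ≠ c`, if it is `1`. -/
lemma apply_concat (σ : autInf) (x : Word) (c : Bool) :
    σ.1 (x ++ [c]) = σ.1 x ++ [if par σ x = 0 then c else !c] := by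
  obtain ⟨d, hd⟩ := apply_concat_eq σ x a
  obtain ⟨e, he⟩ := apply_concat_eq σ x b
  have hde : d ≠ e := by
    rintro rfl
    have := σ.1.injective (hd.trans he.symm)
    simp [a, b] at this
  unfold par
  rw [hd]
  cases c <;> cases d <;> cases e <;> simp_all [a, b]

lemma par_mul (σ τ : autInf) (x : Word) :
    par (σ * τ) x = if par σ (τ.1 x) = par τ x then 0 else 1 := by
  have h1 := apply_concat τ x a
  have h2 := apply_concat σ (τ.1 x) (if par τ x = 0 then a else !a)
  have h3 : par (σ * τ) x =
      if σ.1 (τ.1 (x ++ [a])) = σ.1 (τ.1 x) ++ [a] then 0 else 1 := rfl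
  rw [h3, h1, h2]
  rcases par_eq τ x with h | h <;> rcases par_eq σ (τ.1 x) with h' | h' <;> simp [h, h', a]

lemma sum_step (τ : autInf) (x : Word) (c : Bool) (F : Word → ℤ_[2]) :
    ∑ t : Bool, F (τ.1 (x ++ [c, t])) =
      ∑ t : Bool, F (τ.1 x ++ [if par τ x = 0 then c else !c, t]) := by
  have h : ∀ t, τ.1 (x ++ [c, t]) = τ.1 x ++
      [if par τ x = 0 then c else !c, if par τ (x ++ [c]) = 0 then t else !t] := by
    intro t
    have h1 := apply_concat τ (x ++ [c]) t
    rw [apply_concat τ x c] at h1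
    simpa using h1
  simp only [h]
  rcases par_eq τ (x ++ [c]) with h' | h' <;> simp [h', add_comm]

/-- The defect `Q(σ,τ(x)) + P(σ,x₀) Q(τ,x) - Q(στ,x)`. -/
noncomputable def Z (σ τ : autInf) (x : Word) : ℤ_[2] :=
  Q σ (τ.1 x) + P σ [] * Q τ x - Q (σ * τ) x

lemma Z_next (σ τ : autInf) (x : Word) :
    Z σ τ x = 2 * ∑ t : Bool, Z σ τ (x ++ [a, t]) - par τ x * (P σ (τ.1 x) - P σ []) := by
  have ha := sum_step τ x a (Q σ)
  have h0 : P σ (τ.1 x) = _ := rfl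
  have hs : ∑ t : Bool, Z σ τ (x ++ [a, t]) = ∑ t : Bool, Q σ (τ.1 (x ++ [a, t]))
      + P σ [] * ∑ t : Bool, Q τ (x ++ [a, t]) - ∑ t : Bool, Q (σ * τ) (x ++ [a, t]) := by
    simp only [Z, Fintype.sum_bool]; ring
  rw [hs, ha, h0]
  unfold Z P
  rw [Q_next σ (τ.1 x), Q_next τ x, Q_next (σ * τ) x, par_mul]
  rcases par_eq τ x with h | h <;> rcases par_eq σ (τ.1 x) with h' | h' <;>
    simp [h, h', a, b] <;> ring

lemma dvd_Z {n : ℕ} {σ : autInf} (hσ : CongrUpTo n σ) (τ : autInf) (x : Word) :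
    (2 : ℤ_[2]) ^ ((n - x.length + 1) / 2) ∣ Z σ τ x := by
  by_cases hx : x.length < n
  · have ih : ∀ t, (2 : ℤ_[2]) ^ ((n - (x ++ [a, t]).length + 1) / 2) ∣ Z σ τ (x ++ [a, t]) :=
      fun t => dvd_Z hσ τ (x ++ [a, t])
    rw [Z_next]
    refine dvd_sub ?_ ((?_ : _ ∣ _).mul_left _)
    · rw [Finset.mul_sum]
      refine Finset.dvd_sum fun t _ => ?_
      refine dvd_trans ?_ (mul_dvd_mul_left 2 (ih t))
      rw [← pow_succ']
      refine pow_dvd_pow _ ?_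
      simp only [List.length_append, List.length_cons, List.length_nil]
      omega
    · have := hσ (τ.1 x) (by rw [length_apply]; omega)
      rwa [length_apply] at this
  · have : (n - x.length + 1) / 2 = 0 := by omega
    rw [this, pow_zero]
    exact one_dvd _
termination_by n - x.length
decreasing_by simp; omega

lemma dvd_P_mul {n : ℕ} {σ : autInf} (hσ : CongrUpTo n σ) (τ : autInf) (x : Word)
    (hx : x.length ≤ n) :
    (2 : ℤ_[2]) ^ ((n - x.length + 1) / 2) ∣ P σ [] * P τ x - P (σ * τ) x := by
  have key : P σ [] * P τ x - P (σ * τ) x =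
      2 * ∑ t : Bool, Z σ τ (x ++ [b, t]) - 2 * ∑ t : Bool, Z σ τ (x ++ [a, t])
        - (-1) ^ par τ x * (P σ (τ.1 x) - P σ []) := by
    have ha := sum_step τ x a (Q σ)
    have hb := sum_step τ x b (Q σ)
    have hs : ∀ c, ∑ t : Bool, Z σ τ (x ++ [c, t]) = ∑ t : Bool, Q σ (τ.1 (x ++ [c, t]))
        + P σ [] * ∑ t : Bool, Q τ (x ++ [c, t]) - ∑ t : Bool, Q (σ * τ) (x ++ [c, t]) := by
      intro c
      simp only [Z, Fintype.sum_bool]; ring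
    have h0 : P σ (τ.1 x) = _ := rfl
    have h1 : P τ x = _ := rfl
    have h2 : P (σ * τ) x = _ := rfl
    rw [hs, hs, ha, hb, h0, h1, h2]
    generalize P σ [] = p
    unfold P
    rw [par_mul]
    rcases par_eq τ x with h | h <;> rcases par_eq σ (τ.1 x) with h' | h' <;>
      simp [h, h', a, b] <;> ring
  rw [key]
  have hz : ∀ c, (2 : ℤ_[2]) ^ ((n - x.length + 1) / 2) ∣ 2 * ∑ t : Bool, Z σ τ (x ++ [c, t]) := by
    intro c
    rw [Finset.mul_sum]
    refine Finset.dvd_sum fun t _ => ?_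
    refine dvd_trans ?_ (mul_dvd_mul_left 2 (dvd_Z hσ τ _))
    rw [← pow_succ']
    refine pow_dvd_pow _ ?_
    simp only [List.length_append, List.length_cons, List.length_nil]
    omega
  refine dvd_sub (dvd_sub (hz b) (hz a)) (Dvd.dvd.mul_left ?_ _)
  have := hσ (τ.1 x) (by rw [length_apply]; omega)
  rwa [length_apply] at this

lemma pow_dvd_aux {n : ℕ} (x : Word) :
    (2 : ℤ_[2]) ^ ((n - x.length + 1) / 2) ∣ (2 : ℤ_[2]) ^ ((n - ([] : Word).length + 1) / 2) :=
  pow_dvd_pow _ (by simp only [List.length_nil]; omega)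

lemma congrUpTo_mul {n : ℕ} {σ τ : autInf} (hσ : CongrUpTo n σ) (hτ : CongrUpTo n τ) :
    CongrUpTo n (σ * τ) := by
  intro x hx
  have h1 := dvd_P_mul hσ τ x hx
  have h2 := (pow_dvd_aux x).trans (dvd_P_mul hσ τ [] (by simp))
  have h3 := (hτ x hx).mul_left (P σ [])
  have e : P (σ * τ) x - P (σ * τ) [] = (P σ [] * (P τ x - P τ [])
    - (P σ [] * P τ x - P (σ * τ) x)) + (P σ [] * P τ [] - P (σ * τ) []) := by ring
  rw [e]
  exact (h3.sub h1).add h2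

lemma par_one (x : Word) : par 1 x = 0 := by simp [par]

lemma P_one (x : Word) : P 1 x = 1 := by simp [P, Q, par_one]

lemma isUnit_P (σ : autInf) (x : Word) : IsUnit (P σ x) := by
  by_contra h
  have h2 : (2 : ℤ_[2]) ∣ P σ x := by
    rw [← mem_nonunits_iff, ← IsLocalRing.mem_maximalIdeal, PadicInt.maximalIdeal_eq_span_p,
      Ideal.mem_span_singleton] at h
    simpa using h
  have h3 : (2 : ℤ_[2]) ∣ (-1) ^ par σ x := by
    have e : (-1 : ℤ_[2]) ^ par σ x = P σ x - 2 * ∑ t : Bool, Q σ (x ++ [b, t])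
      + 2 * ∑ t : Bool, Q σ (x ++ [a, t]) := by unfold P; ring
    rw [e]
    exact (h2.sub (dvd_mul_right _ _)).add (dvd_mul_right _ _)
  have h4 : IsUnit (2 : ℤ_[2]) :=
    isUnit_of_dvd_unit h3 ((isUnit_one.neg).pow _)
  have h5 : ¬ IsUnit ((2 : ℕ) : ℤ_[2]) := PadicInt.prime_p.not_isUnit
  exact h5 (by simpa using h4)

lemma congrUpTo_one (n : ℕ) : CongrUpTo n 1 := by
  intro x _
  simp [P_one]

lemma congrUpTo_inv {n : ℕ} {σ : autInf} (hσ : CongrUpTo n σ) : CongrUpTo n σ⁻¹ := by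
  intro x hx
  have h1 := dvd_P_mul hσ σ⁻¹ x hx
  have h2 := (pow_dvd_aux x).trans (dvd_P_mul hσ σ⁻¹ [] (by simp))
  rw [mul_inv_cancel, P_one] at h1 h2
  have h := h1.sub h2
  have e : P σ [] * P σ⁻¹ x - 1 - (P σ [] * P σ⁻¹ [] - 1)
    = P σ [] * (P σ⁻¹ x - P σ⁻¹ []) := by ring
  rw [e] at h
  exact (isUnit_P σ []).dvd_mul_left.1 h

lemma forall_congrUpTo_iff (σ : autInf) :
    (∀ n, CongrUpTo n σ) ↔ ∀ x, P σ x = P σ [] := by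
  refine ⟨fun h x => ?_, fun h n x _ => by rw [h x, sub_self]; exact dvd_zero _⟩
  rw [← sub_eq_zero]
  by_contra hne
  refine hne (eq_zero_of_forall_pow_dvd fun k => ?_)
  have := h (x.length + 2 * k) x (by omega)
  rwa [show (x.length + 2 * k - x.length + 1) / 2 = k by omega] at this
where
  eq_zero_of_forall_pow_dvd {z : ℤ_[2]} (h : ∀ k : ℕ, (2 : ℤ_[2]) ^ k ∣ z) : z = 0 := by
    by_contra hz
    have hf : FiniteMultiplicity (2 : ℤ_[2]) z := by
      refine FiniteMultiplicity.of_prime_left ?_ hz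
      simpa using PadicInt.prime_p (p := 2)
    exact hf.not_pow_dvd_of_multiplicity_lt (Nat.lt_succ_self _) (h _)

/-- Every automorphism of `T_n` has an extension to `T_∞`. -/
lemma exists_extends {n : ℕ} (τ : autFin n) : ∃ σ : autInf, Extends σ τ := by
  have hdrop : ∀ (ρ : autFin n) (w : WordLE n), (ρ.1 w.parent).1 = (ρ.1 w).1.dropLast :=
    fun ρ w => congrArg Subtype.val (ρ.2 w).2
  have hlen : ∀ (ρ : autFin n) (w : WordLE n), (ρ.1 w).1.length = w.1.length :=
    fun ρ w => (ρ.2 w).1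
  have htake : ∀ w : Word, (w.take n).length ≤ n := fun w => by simp
  let F : autFin n → Word → Word := fun ρ w => (ρ.1 ⟨w.take n, htake w⟩).1 ++ w.drop n
  have hFin : ∀ (ρ : autFin n) (w : WordLE n), F ρ w.1 = (ρ.1 w).1 := by
    intro ρ w
    have h1 : w.1.take n = w.1 := List.take_of_length_le w.2
    have h2 : w.1.drop n = [] := List.drop_of_length_le w.2
    simp [F, h1, h2]
  have hFt : ∀ (ρ : autFin n) (w : Word), (F ρ w).take n = (ρ.1 ⟨w.take n, htake w⟩).1 := by
    intro ρ w
    have hl := hlen ρ ⟨w.take n, htake w⟩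
    by_cases hw : w.length ≤ n
    · have h2 : w.drop n = [] := List.drop_of_length_le hw
      simp only [F, h2, List.append_nil]
      exact List.take_of_length_le (by rw [hl]; exact htake w)
    · exact List.take_left' (by rw [hl, List.length_take]; omega)
  have hFd : ∀ (ρ : autFin n) (w : Word), (F ρ w).drop n = w.drop n := by
    intro ρ w
    have hl := hlen ρ ⟨w.take n, htake w⟩
    by_cases hw : w.length ≤ n
    · have h2 : w.drop n = [] := List.drop_of_length_le hw
      simp only [F, h2, List.append_nil]
      exact List.drop_of_length_le (by rw [hl]; exact htake w)
    · exact List.drop_left' (by rw [hl, List.length_take]; omega)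
  have hFF : ∀ (ρ ρ' : autFin n) (w : Word), F ρ (F ρ' w) = F (ρ * ρ') w := by
    intro ρ ρ' w
    have e : (⟨(F ρ' w).take n, htake _⟩ : WordLE n) = ρ'.1 ⟨w.take n, htake w⟩ :=
      Subtype.ext (hFt ρ' w)
    change (ρ.1 ⟨(F ρ' w).take n, htake _⟩).1 ++ (F ρ' w).drop n = _
    rw [e, hFd]
    rfl
  have hF1 : ∀ w, F 1 w = w := by intro w; simp [F]
  have hFl : ∀ (ρ : autFin n) (w : Word), (F ρ w).length = w.length := by
    intro ρ w
    have hl := hlen ρ ⟨w.take n, htake w⟩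
    simp only [F, List.length_append, hl, List.length_take, List.length_drop]
    omega
  let e : Equiv.Perm Word :=
    { toFun := F τ
      invFun := F τ⁻¹
      left_inv := fun w => by rw [hFF, inv_mul_cancel, hF1]
      right_inv := fun w => by rw [hFF, mul_inv_cancel, hF1] }
  refine ⟨⟨e, fun w => ⟨hFl τ w, ?_⟩⟩, hFin τ⟩
  change F τ w.dropLast = (F τ w).dropLast
  by_cases hw : w.length ≤ n
  · have h1 := hFin τ ⟨w, hw⟩
    have h2 := hFin τ (WordLE.parent ⟨w, hw⟩)
    rw [hdrop] at h2
    exact h2.trans (congrArg List.dropLast h1.symm)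
  · obtain ⟨v, c, rfl⟩ : ∃ v c, w = v ++ [c] := by
      have hne : w ≠ [] := by rintro rfl; simp at hw
      exact ⟨_, _, (List.dropLast_append_getLast hne).symm⟩
    have hv : n ≤ v.length := by simp at hw; omega
    rw [List.dropLast_concat]
    have h1 : (v ++ [c]).take n = v.take n := List.take_append_of_le_length hv
    have h2 : (v ++ [c]).drop n = v.drop n ++ [c] := List.drop_append_of_le_length hv
    simp only [F, h1, h2, ← List.append_assoc, List.dropLast_concat]

lemma Extends.mul {n : ℕ} {σ σ' : autInf} {τ τ' : autFin n} (h : Extends σ τ)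
    (h' : Extends σ' τ') : Extends (σ * σ') (τ * τ') := by
  intro w
  change σ.1 (σ'.1 w.1) = (τ.1 (τ'.1 w)).1
  rw [h' w, h]

lemma Extends.inv {n : ℕ} {σ : autInf} {τ : autFin n} (h : Extends σ τ) :
    Extends σ⁻¹ τ⁻¹ := by
  intro w
  have h1 := h (τ⁻¹.1 w)
  have h2 : τ.1 (τ⁻¹.1 w) = w := τ.1.apply_symm_apply w
  rw [h2] at h1
  exact (σ.1.symm_apply_eq).2 h1.symm

/-! ### The arithmetic basilica groups -/

/-- The arithmetic basilica group `M_∞`: all `σ` for which `P(σ,x)` is the same at all nodes. -/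
def MInf : Subgroup autInf where
  carrier := {σ | ∀ x : Word, P σ x = P σ []}
  mul_mem' := by
    intro σ τ hσ hτ
    exact (forall_congrUpTo_iff _).1 fun n =>
      congrUpTo_mul ((forall_congrUpTo_iff σ).2 hσ n) ((forall_congrUpTo_iff τ).2 hτ n)
  one_mem' := (forall_congrUpTo_iff _).1 congrUpTo_one
  inv_mem' := by
    intro σ hσ
    exact (forall_congrUpTo_iff _).1 fun n => congrUpTo_inv ((forall_congrUpTo_iff σ).2 hσ n)

/-- The group `M_n`: all `τ ∈ Aut(T_n)` with `P(τ,x) ≡ P(τ,x₀) (mod 2^⌊(n-m+1)/2⌋)` for all nodes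
`x` of `T_n`, where `m` is the level of `x`, and where `P(τ,x)` modulo this power of `2` is
computed from any extension of `τ` to `T_∞`. -/
def MFin (n : ℕ) : Subgroup (autFin n) where
  carrier := {τ | ∀ σ : autInf, Extends σ τ → CongrUpTo n σ}
  mul_mem' := by
    intro τ τ' h h' σ hσ
    obtain ⟨ρ, hρ⟩ := exists_extends τ'
    have h1 : Extends (σ * ρ⁻¹) τ := by
      have := hσ.mul hρ.inv
      rwa [mul_inv_cancel_right] at this
    have h2 := congrUpTo_mul (h _ h1) (h' _ hρ)
    rwa [inv_mul_cancel_right] at h2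
  one_mem' := by
    intro σ hσ x hx
    have hid : ∀ w : Word, w.length ≤ n → σ.1 w = w := fun w hw => hσ ⟨w, hw⟩
    have hpar : ∀ w : Word, w.length < n → par σ w = 0 := by
      intro w hw
      unfold par
      rw [hid _ (by simpa using hw), hid w hw.le, if_pos rfl]
    have hQ : ∀ (k : ℕ) (y : Word), n ≤ y.length + 2 * k → (2 : ℤ_[2]) ^ ((n - y.length + 1) / 2)
        ∣ Q σ y := by
      intro k
      induction k with
      | zero =>
        intro y hy
        rw [show (n - y.length + 1) / 2 = 0 by omega, pow_zero]
        exact one_dvd _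
      | succ k ih =>
        intro y hy
        by_cases hyn : y.length < n
        · rw [Q_next, hpar y hyn, Nat.cast_zero, zero_add, Finset.mul_sum]
          refine Finset.dvd_sum fun t _ => ?_
          refine dvd_trans ?_ (mul_dvd_mul_left 2 (ih (y ++ [a, t]) (by simp; omega)))
          rw [← pow_succ']
          refine pow_dvd_pow _ ?_
          simp only [List.length_append, List.length_cons, List.length_nil]
          omega
        · rw [show (n - y.length + 1) / 2 = 0 by omega, pow_zero]
          exact one_dvd _
    have hP : ∀ y : Word, y.length < n → (2 : ℤ_[2]) ^ ((n - y.length + 1) / 2) ∣ P σ y - 1 := by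
      intro y hy
      have hc : ∀ c, (2 : ℤ_[2]) ^ ((n - y.length + 1) / 2) ∣
          2 * ∑ t : Bool, Q σ (y ++ [c, t]) := by
        intro c
        rw [Finset.mul_sum]
        refine Finset.dvd_sum fun t _ => ?_
        refine dvd_trans ?_ (mul_dvd_mul_left 2 (hQ n (y ++ [c, t]) (by omega)))
        rw [← pow_succ']
        refine pow_dvd_pow _ ?_
        simp only [List.length_append, List.length_cons, List.length_nil]
        omega
      have e : P σ y - 1 = 2 * ∑ t : Bool, Q σ (y ++ [b, t]) -
          2 * ∑ t : Bool, Q σ (y ++ [a, t]) := by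
        unfold P
        rw [hpar y hy]
        ring
      rw [e]
      exact (hc b).sub (hc a)
    by_cases hxn : x.length < n
    · have h2 := (pow_dvd_aux x).trans (hP [] (by simp; omega))
      have h3 := (hP x hxn).sub h2
      rwa [sub_sub_sub_cancel_right] at h3
    · rw [show (n - x.length + 1) / 2 = 0 by omega, pow_zero]
      exact one_dvd _
  inv_mem' := by
    intro τ h σ hσ
    have h1 : Extends σ⁻¹ τ := by simpa using hσ.inv
    have h2 := congrUpTo_inv (h _ h1)
    rwa [inv_inv] at h2

/-! ### The backward orbit of `x₀` under `f(z) = z² - 1`, and its Galois groups -/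

section Galois

variable {K : Type*} [Field K] (Kbar : Type*) [Field Kbar] [Algebra K Kbar]

/-- The set `f^{-n}(x₀)` of the solutions `z` in `Kbar` of `f^n(z) = x₀`, where `f(z) = z² - 1`. -/
def preimages (x₀ : K) (n : ℕ) : Set Kbar :=
  {z | (fun z : Kbar => z ^ 2 - 1)^[n] z = algebraMap K Kbar x₀}

/-- The field `K_n = K(f^{-n}(x₀))`. -/
def fieldFin (x₀ : K) (n : ℕ) : IntermediateField K Kbar :=
  IntermediateField.adjoin K (preimages Kbar x₀ n)

/-- The field `K_∞`, the union of all `K_n`. -/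
def fieldInf (x₀ : K) : IntermediateField K Kbar := ⨆ n, fieldFin Kbar x₀ n

/-- A labeling of the tree of preimages of `x₀`: an isomorphism from the tree of words to it.
The tree of preimages is the disjoint union of its levels `f^{-m}(x₀)`, and `z` lies directly
above `f(z)`. For a word `w`, the value `ν.label w` is the element `[w]` of `Kbar`. -/
structure Labeling (x₀ : K) where
  label : Word → Kbar
  bijOn_level : ∀ m, Set.BijOn label {w | w.length = m} (preimages Kbar x₀ m)
  map_parent : ∀ (w : Word) (c : Bool), label (w ++ [c]) ^ 2 - 1 = label w

variable {Kbar} {x₀ : K}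

/-- The condition on a labeling, relative to a sequence of roots of unity `ζ m = ζ_{2^m}`, that
`∏_{s₁,…,sᵢ} [y a s₁ a s₂ ⋯ a sᵢ a] · (∏_{s₁,…,sᵢ} [y b s₁ a s₂ ⋯ a sᵢ a])⁻¹ = ζ_{2^{i+1}}`
for all nodes `y` and all `i ≥ 0`. -/
def Labeling.Compatible (ν : Labeling Kbar x₀) (ζ : ℕ → Kbar) : Prop :=
  ∀ (y : Word) (i : ℕ),
    (∏ s : Fin i → Bool, ν.label (y ++ [a] ++ zag s)) *
      (∏ s : Fin i → Bool, ν.label (y ++ [b] ++ zag s))⁻¹ = ζ (i + 1)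

lemma iterate_mem_fieldFin (n k : ℕ) {z : Kbar} (hz : z ∈ fieldFin Kbar x₀ n) :
    (fun z : Kbar => z ^ 2 - 1)^[k] z ∈ fieldFin Kbar x₀ n := by
  induction k with
  | zero => exact hz
  | succ k ih =>
    rw [Function.iterate_succ_apply']
    exact sub_mem (pow_mem ih 2) (one_mem _)

lemma Labeling.label_append (ν : Labeling Kbar x₀) (w v : Word) :
    (fun z : Kbar => z ^ 2 - 1)^[v.length] (ν.label (w ++ v)) = ν.label w := by
  induction v using List.reverseRecOn with
  | nil => simp
  | append_singleton v c ih =>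
    rw [List.length_append, List.length_singleton, Function.iterate_succ_apply,
      ← List.append_assoc, ν.map_parent, ih]

lemma Labeling.mem_fieldFin (ν : Labeling Kbar x₀) {n : ℕ} (w : WordLE n) :
    ν.label w.1 ∈ fieldFin Kbar x₀ n := by
  have h := ν.label_append w.1 (List.replicate (n - w.1.length) a)
  rw [← h]
  refine iterate_mem_fieldFin n _ (IntermediateField.subset_adjoin _ _ ?_)
  refine (ν.bijOn_level n).mapsTo ?_
  have := w.2
  simp only [Set.mem_ofPred_eq, List.length_append, List.length_replicate]
  omega

lemma Labeling.mem_fieldInf (ν : Labeling Kbar x₀) (w : Word) :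
    ν.label w ∈ fieldInf Kbar x₀ :=
  (le_iSup (fieldFin Kbar x₀) w.length) (ν.mem_fieldFin ⟨w, le_rfl⟩)

/-- The node of `T_n` with label `w`, as an element of `K_n`. -/
def Labeling.nodeFin (ν : Labeling Kbar x₀) {n : ℕ} (w : WordLE n) : fieldFin Kbar x₀ n :=
  ⟨ν.label w.1, ν.mem_fieldFin w⟩

/-- The node of `T_∞` with label `w`, as an element of `K_∞`. -/
def Labeling.nodeInf (ν : Labeling Kbar x₀) (w : Word) : fieldInf Kbar x₀ :=
  ⟨ν.label w, ν.mem_fieldInf w⟩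

/-- `G_n ≅ M_n` as groups acting on the tree `T_n`, where `G_n = Gal(K_n/K)`: there is a group
isomorphism which is equivariant for the actions on the nodes. -/
def IsoFin (ν : Labeling Kbar x₀) (n : ℕ) : Prop :=
  ∃ φ : (fieldFin Kbar x₀ n ≃ₐ[K] fieldFin Kbar x₀ n) ≃* MFin n,
    ∀ (g : fieldFin Kbar x₀ n ≃ₐ[K] fieldFin Kbar x₀ n) (w : WordLE n),
      g (ν.nodeFin w) = ν.nodeFin ((φ g).1.1 w)

/-- `G_∞ ≅ M_∞` as groups acting on the tree `T_∞`, where `G_∞ = Gal(K_∞/K)`: there is a group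
isomorphism which is equivariant for the actions on the nodes. -/
def IsoInf (ν : Labeling Kbar x₀) : Prop :=
  ∃ φ : (fieldInf Kbar x₀ ≃ₐ[K] fieldInf Kbar x₀) ≃* MInf,
    ∀ (g : fieldInf Kbar x₀ ≃ₐ[K] fieldInf Kbar x₀) (w : Word),
      g (ν.nodeInf w) = ν.nodeInf ((φ g).1.1 w)

end Galois

end Basilica

namespace Basilica

/-! ### Automorphisms of the tree and their sections -/

/-! Galois side. Let `g` act on the tree by `σ`. Applying `g` to the product relations of a
compatible labeling, and counting which factors switch between the letters `a` and `b`, gives `g ζ =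
ζ ^ P(σ,x)` for every root of unity `ζ` of 2-power order in the chosen sequence and every node `x`
(`map_zagProd`, `map_root`). The left side does not involve `x`. So the Galois group always acts
through `M_∞`, and there `P` is the 2-adic cyclotomic character (`act_mem_MInf`). The question is
when the image is everything.

Group side. On each `T_n`, an element with multiplier `P = 1` is a product of the basilica
generators α = (1, β) and β = swap·(1, α) and their inverses (`exists_basilica_agree`). A multiplier
that is 1 modulo 8 is a square, so an element of `M_n` with such a multiplier is γ²d on `T_n`, with
γ in `M_∞` and d in the basilica group (`exists_agree_sq_mul`). Hence each character of the 2-group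
`M_n` with values in `ZMod 2` is governed by the sign at the root, the sign of level one and the
multiplier modulo 8. Since a proper subgroup of a finite 2-group lies in one of index two, a
subgroup that realizes all 2·2·4 = 16 values of these invariants is `M_n` (`MFin_le_of_invariants`).

Dictionary. Up to sign, √(1+x₀) is `[a]` and √(-x₀) is `[aa][ba]`, so the three invariants describe
the action on √(1+x₀), √(-x₀) and ζ₈. They take all 16 values exactly when the degree is 16
(`finrank_adjoin_eq_sixteen_iff`). Level 5 enters because ⌊(5+1)/2⌋ = 3, so that `T_5` sees the
multiplier modulo 8. The count `card_MFin_five` turns the condition on `G_5` into one on its degree,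
and compactness passes from all finite levels to `T_∞` (`exists_galInf_eq`). -/

lemma autInf_ext {σ τ : autInf} (h : ∀ w, σ.1 w = τ.1 w) : σ = τ :=
  Subtype.ext (Equiv.ext h)

/-- An injective map of words which preserves levels and parents is a tree automorphism. -/
noncomputable def ofInjective (f : Word → Word) (hl : ∀ w, (f w).length = w.length)
    (hd : ∀ w, f w.dropLast = (f w).dropLast) (hf : Function.Injective f) : autInf :=
  ⟨Equiv.ofBijective f ⟨hf, fun w => by
    -- Each level is finite and preserved, so injectivity gives surjectivity level by level.
    have hfin : Finite {v : Word // v.length = w.length} := List.finite_length_eq Bool w.length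
    let F : {v : Word // v.length = w.length} → {v : Word // v.length = w.length} :=
      fun v => ⟨f v.1, (hl _).trans v.2⟩
    have hF : Function.Injective F := fun u v huv => Subtype.ext (hf (congrArg Subtype.val huv))
    obtain ⟨v, hv⟩ := Finite.injective_iff_surjective.1 hF ⟨w, rfl⟩
    exact ⟨v.1, congrArg Subtype.val hv⟩⟩, fun w => ⟨hl w, hd w⟩⟩

@[simp] lemma ofInjective_apply (f : Word → Word) (hl) (hd) (hf) (w : Word) :
    (ofInjective f hl hd hf).1 w = f w := rfl

@[simp] lemma one_apply (w : Word) : (1 : autInf).1 w = w := rfl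

lemma mul_apply (σ τ : autInf) (w : Word) : (σ * τ).1 w = σ.1 (τ.1 w) := rfl

lemma apply_inv_self (σ : autInf) (w : Word) : σ.1 ((σ⁻¹).1 w) = w :=
  σ.1.apply_symm_apply w

@[simp] lemma apply_nil (σ : autInf) : σ.1 [] = [] :=
  List.length_eq_zero_iff.1 (length_apply σ [])

/-- The action of `σ` on the letters at level one. -/
def rootPerm (σ : autInf) (c : Bool) : Bool := if par σ [] = 0 then c else !c

lemma apply_cons_tail (σ : autInf) (c : Bool) (w : Word) :
    σ.1 (c :: w) = rootPerm σ c :: (σ.1 (c :: w)).tail := by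
  induction w using List.reverseRecOn with
  | nil =>
    have h := apply_concat σ [] c
    rw [apply_nil, List.nil_append, List.nil_append] at h
    rw [h]; rfl
  | append_singleton w d ih =>
    rw [← List.cons_append, apply_concat, ih]
    simp

/-- The section of `σ` at the letter `c`. -/
noncomputable def sec (σ : autInf) (c : Bool) : autInf :=
  ofInjective (fun w => (σ.1 (c :: w)).tail) (fun w => by simp [length_apply])
    (fun w => by
      rcases List.eq_nil_or_concat' w with rfl | ⟨v, d, rfl⟩
      · have h := apply_concat σ [] c
        rw [apply_nil, List.nil_append, List.nil_append] at h
        simp [h]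
      · rw [List.dropLast_concat, ← List.cons_append, apply_concat σ (c :: v) d]
        have : (σ.1 (c :: v)) ≠ [] := by
          rw [apply_cons_tail]; simp
        rw [List.tail_append_of_ne_nil this, List.dropLast_concat])
    (fun v w h => by
      have : σ.1 (c :: v) = σ.1 (c :: w) := by
        rw [apply_cons_tail, apply_cons_tail σ c w]
        exact congrArg _ h
      exact List.tail_eq_of_cons_eq (σ.1.injective this))

lemma apply_cons (σ : autInf) (c : Bool) (w : Word) :
    σ.1 (c :: w) = rootPerm σ c :: (sec σ c).1 w := apply_cons_tail σ c w

lemma par_sec (σ : autInf) (c : Bool) (w : Word) : par (sec σ c) w = par σ (c :: w) := by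
  simp [par, apply_cons]

lemma Q_sec (σ : autInf) (c : Bool) (w : Word) : Q (sec σ c) w = Q σ (c :: w) := by
  simp [Q, par_sec]

lemma P_sec (σ : autInf) (c : Bool) (w : Word) : P (sec σ c) w = P σ (c :: w) := by
  simp [P, par_sec, Q_sec]

lemma sec_eq {σ τ : autInf} {c d : Bool} (h : ∀ w, σ.1 (c :: w) = d :: τ.1 w) : sec σ c = τ := by
  refine autInf_ext fun w => ?_
  have := h w
  rw [apply_cons] at this
  exact List.tail_eq_of_cons_eq this

lemma sec_mul (σ τ : autInf) (c : Bool) : sec (σ * τ) c = sec σ (rootPerm τ c) * sec τ c :=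
  sec_eq (d := rootPerm σ (rootPerm τ c)) fun w => by
    rw [mul_apply, apply_cons, apply_cons, mul_apply]

@[simp] lemma rootPerm_one (c : Bool) : rootPerm 1 c = c := by simp [rootPerm, par_one]

@[simp] lemma sec_one (c : Bool) : sec 1 c = 1 := sec_eq (d := c) fun w => by simp

lemma par_eq_zero_iff_rootPerm (σ : autInf) : par σ [] = 0 ↔ ∀ c, rootPerm σ c = c := by
  unfold rootPerm
  split_ifs with h <;> simp [h]

lemma rootPerm_mul (σ τ : autInf) (c : Bool) :
    rootPerm (σ * τ) c = rootPerm σ (rootPerm τ c) := by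
  have := apply_cons (σ * τ) c []
  rw [mul_apply, apply_cons, apply_cons] at this
  exact (List.head_eq_of_cons_eq this).symm

/-! ### Automorphisms which agree up to some level -/

/-- `σ` and `τ` act in the same way on `T_n`. -/
def AgreeUpTo (n : ℕ) (σ τ : autInf) : Prop := ∀ w : Word, w.length ≤ n → σ.1 w = τ.1 w

lemma AgreeUpTo.symm {n : ℕ} {σ τ : autInf} (h : AgreeUpTo n σ τ) : AgreeUpTo n τ σ :=
  fun w hw => (h w hw).symm

lemma AgreeUpTo.trans {n : ℕ} {σ τ ρ : autInf} (h : AgreeUpTo n σ τ) (h' : AgreeUpTo n τ ρ) :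
    AgreeUpTo n σ ρ := fun w hw => (h w hw).trans (h' w hw)

lemma AgreeUpTo.refl (n : ℕ) (σ : autInf) : AgreeUpTo n σ σ := fun _ _ => rfl

lemma AgreeUpTo.mono {m n : ℕ} (hmn : m ≤ n) {σ τ : autInf} (h : AgreeUpTo n σ τ) :
    AgreeUpTo m σ τ := fun w hw => h w (hw.trans hmn)

lemma AgreeUpTo.mul {n : ℕ} {σ τ σ' τ' : autInf} (h : AgreeUpTo n σ τ)
    (h' : AgreeUpTo n σ' τ') : AgreeUpTo n (σ * σ') (τ * τ') := fun w hw => by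
  rw [mul_apply, mul_apply, h' w hw, h _ (by rwa [length_apply])]

lemma AgreeUpTo.inv {n : ℕ} {σ τ : autInf} (h : AgreeUpTo n σ τ) :
    AgreeUpTo n σ⁻¹ τ⁻¹ := fun w hw => by
  apply τ.1.injective
  rw [apply_inv_self, ← h _ (by rwa [length_apply]), apply_inv_self]

lemma AgreeUpTo.par_eq {n : ℕ} {σ τ : autInf} (h : AgreeUpTo n σ τ) {w : Word}
    (hw : w.length < n) : par σ w = par τ w := by
  unfold par
  rw [h w hw.le, h (w ++ [a]) (by simpa using hw)]

/-- The recursion `Q_next` climbs two levels and gains a factor 2 at each step, so the parities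
below level `n` determine `Q` to this precision. -/
lemma AgreeUpTo.dvd_Q_sub {n : ℕ} {σ τ : autInf} (h : AgreeUpTo n σ τ) (x : Word) :
    (2 : ℤ_[2]) ^ ((n - x.length + 1) / 2) ∣ Q σ x - Q τ x := by
  by_cases hx : x.length < n
  · have ih : ∀ t, (2 : ℤ_[2]) ^ ((n - (x ++ [a, t]).length + 1) / 2) ∣
        Q σ (x ++ [a, t]) - Q τ (x ++ [a, t]) := fun t => h.dvd_Q_sub (x ++ [a, t])
    have e : Q σ x - Q τ x = 2 * ∑ t : Bool, (Q σ (x ++ [a, t]) - Q τ (x ++ [a, t])) := by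
      rw [Q_next σ, Q_next τ, h.par_eq hx, Finset.sum_sub_distrib]
      ring
    rw [e, Finset.mul_sum]
    refine Finset.dvd_sum fun t _ => ?_
    refine dvd_trans ?_ (mul_dvd_mul_left 2 (ih t))
    rw [← pow_succ']
    refine pow_dvd_pow _ ?_
    simp only [List.length_append, List.length_cons, List.length_nil]
    omega
  · have : (n - x.length + 1) / 2 = 0 := by omega
    rw [this, pow_zero]
    exact one_dvd _
termination_by n - x.length
decreasing_by simp; omega

/-- The `Q` terms sit two levels above `x` but carry a factor 2, so nothing is lost compared with
`dvd_Q_sub`. This is why membership in `M_n` can be tested on a single extension. -/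
lemma AgreeUpTo.dvd_P_sub {n : ℕ} {σ τ : autInf} (h : AgreeUpTo n σ τ) (x : Word) :
    (2 : ℤ_[2]) ^ ((n - x.length + 1) / 2) ∣ P σ x - P τ x := by
  by_cases hx : x.length < n
  · have e : P σ x - P τ x = 2 * ∑ t : Bool, (Q σ (x ++ [b, t]) - Q τ (x ++ [b, t])) -
        2 * ∑ t : Bool, (Q σ (x ++ [a, t]) - Q τ (x ++ [a, t])) := by
      unfold P
      rw [h.par_eq hx, Finset.sum_sub_distrib, Finset.sum_sub_distrib]
      ring
    have hc : ∀ c, (2 : ℤ_[2]) ^ ((n - x.length + 1) / 2) ∣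
        2 * ∑ t : Bool, (Q σ (x ++ [c, t]) - Q τ (x ++ [c, t])) := by
      intro c
      rw [Finset.mul_sum]
      refine Finset.dvd_sum fun t _ => ?_
      refine dvd_trans ?_ (mul_dvd_mul_left 2 (h.dvd_Q_sub _))
      rw [← pow_succ']
      refine pow_dvd_pow _ ?_
      simp only [List.length_append, List.length_cons, List.length_nil]
      omega
    rw [e]
    exact (hc b).sub (hc a)
  · have : (n - x.length + 1) / 2 = 0 := by omega
    rw [this, pow_zero]
    exact one_dvd _

lemma AgreeUpTo.congrUpTo {n : ℕ} {σ τ : autInf} (h : AgreeUpTo n σ τ) (hσ : CongrUpTo n σ) :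
    CongrUpTo n τ := fun x hx => by
  have e : P τ x - P τ [] = (P σ x - P σ []) - (P σ x - P τ x) + (P σ [] - P τ []) := by ring
  rw [e]
  exact ((hσ x hx).sub (h.dvd_P_sub x)).add ((pow_dvd_aux x).trans (h.dvd_P_sub []))

/-- The restriction of tree automorphisms to `T_n`. -/
def restrict (n : ℕ) : autInf →* autFin n where
  toFun σ := ⟨σ.1.subtypePerm fun w => by rw [length_apply], fun w =>
    ⟨length_apply σ w.1, Subtype.ext (σ.2 w.1).2⟩⟩
  map_one' := rfl
  map_mul' _ _ := rfl

lemma extends_restrict (n : ℕ) (σ : autInf) : Extends σ (restrict n σ) := fun _ => rfl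

lemma extends_iff {n : ℕ} {σ : autInf} {τ : autFin n} : Extends σ τ ↔ restrict n σ = τ :=
  ⟨fun h => Subtype.ext (Equiv.ext fun w => Subtype.ext (h w)), fun h => h ▸ extends_restrict n σ⟩

lemma restrict_surjective (n : ℕ) : Function.Surjective (restrict n) := fun τ =>
  (exists_extends τ).imp fun _ => extends_iff.1

lemma restrict_eq_iff {n : ℕ} {σ τ : autInf} :
    restrict n σ = restrict n τ ↔ AgreeUpTo n σ τ :=
  ⟨fun h w hw => (extends_iff.2 h) ⟨w, hw⟩, fun h => extends_iff.1 fun w => h w.1 w.2⟩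

lemma restrict_mem_MFin_iff {n : ℕ} {σ : autInf} : restrict n σ ∈ MFin n ↔ CongrUpTo n σ :=
  ⟨fun h => h σ (extends_restrict n σ), fun h _ hρ =>
    (restrict_eq_iff.1 (extends_iff.1 hρ)).symm.congrUpTo h⟩

lemma mem_MInf_iff {σ : autInf} : σ ∈ MInf ↔ ∀ n, CongrUpTo n σ :=
  (forall_congrUpTo_iff σ).symm

/-! ### Exact composition laws for Q and P on M_∞ -/

lemma eq_zero_of_forall_two_pow_dvd {z : ℤ_[2]} (h : ∀ k : ℕ, (2 : ℤ_[2]) ^ k ∣ z) : z = 0 :=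
  forall_congrUpTo_iff.eq_zero_of_forall_pow_dvd h

lemma Z_eq_zero {σ : autInf} (hσ : σ ∈ MInf) (τ : autInf) (x : Word) : Z σ τ x = 0 := by
  refine eq_zero_of_forall_two_pow_dvd fun k => ?_
  have := dvd_Z (mem_MInf_iff.1 hσ (x.length + 2 * k)) τ x
  rwa [show (x.length + 2 * k - x.length + 1) / 2 = k by omega] at this

/-- On `M_∞` the quantity `Q` is a crossed homomorphism, twisted by the multiplier; only the left
factor has to lie in `M_∞`. -/
lemma Q_mul {σ : autInf} (hσ : σ ∈ MInf) (τ : autInf) (x : Word) :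
    Q (σ * τ) x = Q σ (τ.1 x) + P σ [] * Q τ x :=
  (sub_eq_zero.1 (Z_eq_zero hσ τ x)).symm

lemma P_mul {σ : autInf} (hσ : σ ∈ MInf) (τ : autInf) (x : Word) :
    P (σ * τ) x = P σ [] * P τ x := by
  refine (sub_eq_zero.1 (eq_zero_of_forall_two_pow_dvd fun k => ?_)).symm
  have := dvd_P_mul (mem_MInf_iff.1 hσ (x.length + 2 * k)) τ x (by omega)
  rwa [show (x.length + 2 * k - x.length + 1) / 2 = k by omega] at this

/-- `∑_t Q(σ, t)`, the sum over the two nodes at level one. -/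
noncomputable def sumQ (σ : autInf) : ℤ_[2] := ∑ t : Bool, Q σ [t]

/-- Summing over level one absorbs the permutation of nodes in `Q_mul`. Where `P = 1`, `sumQ` is
therefore an honest homomorphism; it will count the exponent of α. -/
lemma sumQ_mul {σ : autInf} (hσ : σ ∈ MInf) (τ : autInf) :
    sumQ (σ * τ) = sumQ σ + P σ [] * sumQ τ := by
  have h : ∑ t : Bool, Q σ (τ.1 [t]) = ∑ t : Bool, Q σ [t] := by
    have : ∀ t, τ.1 [t] = [rootPerm τ t] := fun t => by rw [apply_cons]; simp
    simp only [this, rootPerm]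
    split_ifs <;> simp [add_comm]
  simp only [sumQ, Q_mul hσ, Finset.sum_add_distrib, Finset.mul_sum, h]

lemma P_nil_eq (σ : autInf) :
    P σ [] = (-1) ^ par σ [] + 2 * sumQ (sec σ b) - 2 * sumQ (sec σ a) := by
  simp [P, sumQ, Q_sec]

lemma AgreeUpTo.dvd_sumQ_sub {n : ℕ} {σ τ : autInf} (h : AgreeUpTo n σ τ) :
    (2 : ℤ_[2]) ^ (n / 2) ∣ sumQ σ - sumQ τ := by
  by_cases hn : n = 0
  · simp [hn]
  · rw [sumQ, sumQ, ← Finset.sum_sub_distrib]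
    refine Finset.dvd_sum fun t _ => ?_
    have := h.dvd_Q_sub [t]
    rwa [List.length_singleton, Nat.sub_add_cancel (by omega)] at this

lemma sumQ_sec_eq (σ : autInf) (c : Bool) :
    sumQ (sec σ c) = ∑ t : Bool, Q σ [c, t] := by simp [sumQ, Q_sec]

lemma Q_nil_eq (σ : autInf) : Q σ [] = par σ [] + 2 * sumQ (sec σ a) := by
  rw [Q_next, sumQ_sec_eq]; rfl

lemma sumQ_eq (σ : autInf) : sumQ σ = Q (sec σ a) [] + Q (sec σ b) [] := by
  rw [Q_sec, Q_sec, sumQ, Fintype.sum_bool, add_comm]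

/-! ### The generators of the geometric group -/

/-- The maps underlying the two generators of the basilica group. -/
def basilicaFun : Bool → Word → Word
  | _, [] => []
  | false, false :: w => a :: w
  | false, true :: w => b :: basilicaFun true w
  | true, false :: w => b :: w
  | true, true :: w => a :: basilicaFun false w

lemma length_basilicaFun (k : Bool) (w : Word) : (basilicaFun k w).length = w.length := by
  induction w generalizing k with
  | nil => simp [basilicaFun]
  | cons c w ih => cases k <;> cases c <;> simp [basilicaFun, ih]

lemma basilicaFun_dropLast (k : Bool) (w : Word) :
    basilicaFun k w.dropLast = (basilicaFun k w).dropLast := by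
  induction w generalizing k with
  | nil => simp [basilicaFun]
  | cons c w ih =>
    have h : ∀ k, basilicaFun k w = [] ↔ w = [] := fun k => by
      rw [← List.length_eq_zero_iff, length_basilicaFun, List.length_eq_zero_iff]
    by_cases hw : w = []
    · subst hw
      cases k <;> cases c <;> simp [basilicaFun]
    · cases k <;> cases c <;>
        simp [basilicaFun, ih, List.dropLast_cons_of_ne_nil, hw, h]

lemma basilicaFun_injective (k : Bool) : Function.Injective (basilicaFun k) := by
  intro v w
  induction v generalizing k w with
  | nil =>
    intro h
    have := congrArg List.length h
    simp only [length_basilicaFun, List.length_nil] at this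
    exact (List.length_eq_zero_iff.1 this.symm).symm
  | cons c v ih =>
    cases w with
    | nil =>
      intro h
      have := congrArg List.length h
      simp [length_basilicaFun] at this
    | cons d w =>
      cases k <;> cases c <;> cases d <;> simp [basilicaFun, a, b] <;> exact fun h => ih _ h

/-- The generator `α`, which acts as `β` above `b`. -/
noncomputable def al : autInf :=
  ofInjective (basilicaFun false) (length_basilicaFun _) (basilicaFun_dropLast _)
    (basilicaFun_injective _)

/-- The generator `β`, which switches the two letters, acting as `α` above `b`. -/
noncomputable def be : autInf :=
  ofInjective (basilicaFun true) (length_basilicaFun _) (basilicaFun_dropLast _)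
    (basilicaFun_injective _)

lemma al_a (w : Word) : al.1 (a :: w) = a :: w := by simp [al, basilicaFun]
lemma al_b (w : Word) : al.1 (b :: w) = b :: be.1 w := by simp [al, be, basilicaFun]
lemma be_a (w : Word) : be.1 (a :: w) = b :: w := by simp [be, basilicaFun]
lemma be_b (w : Word) : be.1 (b :: w) = a :: al.1 w := by simp [al, be, basilicaFun]

@[simp] lemma sec_al_a : sec al a = 1 := sec_eq (d := a) fun w => by rw [al_a]; rfl
@[simp] lemma sec_al_b : sec al b = be := sec_eq (d := b) al_b
@[simp] lemma sec_be_a : sec be a = 1 := sec_eq (d := b) fun w => by rw [be_a]; rfl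
@[simp] lemma sec_be_b : sec be b = al := sec_eq (d := a) be_b

@[simp] lemma par_al : par al [] = 0 := by simp [par, al_a]
@[simp] lemma par_be : par be [] = 1 := by simp [par, be_a]
@[simp] lemma rootPerm_al (c : Bool) : rootPerm al c = c := by simp [rootPerm]
@[simp] lemma rootPerm_be (c : Bool) : rootPerm be c = !c := by simp [rootPerm]

@[simp] lemma Q_one (x : Word) : Q 1 x = 0 := by simp [Q, par_one]
@[simp] lemma sumQ_one : sumQ 1 = 0 := by simp [sumQ]

lemma Q_al : Q al [] = 0 := by rw [Q_nil_eq]; simp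
lemma Q_be : Q be [] = 1 := by rw [Q_nil_eq]; simp
@[simp] lemma sumQ_al : sumQ al = 1 := by rw [sumQ_eq]; simp [Q_be]
@[simp] lemma sumQ_be : sumQ be = 0 := by rw [sumQ_eq]; simp [Q_al]

/-- Sections of the generators are again generators or trivial, so only the root matters. There `P`
is 1 + 2·0 - 2·0 for α and -1 + 2·1 - 2·0 for β. -/
lemma P_al_be (x : Word) : P al x = 1 ∧ P be x = 1 := by
  induction x with
  | nil =>
    rw [P_nil_eq, P_nil_eq]
    simp
    norm_num
  | cons c x ih =>
    cases c
    · rw [← P_sec, ← P_sec]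
      change P (sec al a) x = 1 ∧ P (sec be a) x = 1
      simp [P_one]
    · rw [← P_sec, ← P_sec]
      change P (sec al b) x = 1 ∧ P (sec be b) x = 1
      simp [ih]

/-- The automorphisms with `P(σ,x) = 1` for all `x`. -/
def geomInf : Subgroup autInf where
  carrier := {σ | ∀ x, P σ x = 1}
  one_mem' := P_one
  mul_mem' := by
    intro σ τ hσ hτ
    have h1 : σ ∈ MInf := fun x => by rw [hσ, hσ]
    intro x
    rw [P_mul h1, hσ, hτ, one_mul]
  inv_mem' := by
    intro σ hσ x
    have h1 : σ ∈ MInf := fun x => by rw [hσ, hσ]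
    have h := P_mul h1 σ⁻¹ x
    rw [mul_inv_cancel, P_one, hσ, one_mul] at h
    exact h.symm

lemma geomInf_le_MInf : geomInf ≤ MInf := fun σ hσ x => by rw [hσ, hσ]

/-- The basilica group. -/
def basilica : Subgroup autInf := Subgroup.closure {al, be}

lemma al_mem : al ∈ basilica := Subgroup.subset_closure (by simp)
lemma be_mem : be ∈ basilica := Subgroup.subset_closure (by simp)

lemma basilica_le_geomInf : basilica ≤ geomInf := by
  refine (Subgroup.closure_le _).2 ?_
  rintro σ (rfl | rfl)
  · exact fun x => (P_al_be x).1
  · exact fun x => (P_al_be x).2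

lemma sumQ_mul_of_mem_geomInf {σ : autInf} (hσ : σ ∈ geomInf) (τ : autInf) :
    sumQ (σ * τ) = sumQ σ + sumQ τ := by
  rw [sumQ_mul (geomInf_le_MInf hσ), hσ, one_mul]

lemma sumQ_inv_of_mem_geomInf {σ : autInf} (hσ : σ ∈ geomInf) : sumQ σ⁻¹ = -sumQ σ := by
  have := sumQ_mul_of_mem_geomInf hσ σ⁻¹
  rw [mul_inv_cancel, sumQ_one] at this
  linear_combination -this

lemma sumQ_al_zpow (k : ℤ) : sumQ (al ^ k) = k := by
  have hal := basilica_le_geomInf al_mem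
  induction k with
  | zero => simp
  | succ k ih =>
    rw [zpow_add_one, sumQ_mul_of_mem_geomInf (zpow_mem hal _), ih]
    simp
  | pred k ih =>
    rw [zpow_sub_one, sumQ_mul_of_mem_geomInf (zpow_mem hal _), ih, sumQ_inv_of_mem_geomInf hal]
    simp [sub_eq_add_neg]

/-! ### Lifting elements through sections -/

/-- The stabilizer of level one. -/
def rootStab : Subgroup autInf where
  carrier := {σ | ∀ c, rootPerm σ c = c}
  one_mem' := rootPerm_one
  mul_mem' := by
    intro σ τ hσ hτ c
    rw [rootPerm_mul, hτ, hσ]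
  inv_mem' := by
    intro σ hσ c
    have h := rootPerm_mul σ⁻¹ σ c
    rw [inv_mul_cancel, rootPerm_one, hσ c] at h
    exact h.symm

/-- The section at `c`, as a homomorphism on the stabilizer of level one. -/
noncomputable def secHom (c : Bool) : rootStab →* autInf where
  toFun σ := sec σ.1 c
  map_one' := sec_one c
  map_mul' σ τ := by
    change sec (σ.1 * τ.1) c = _
    rw [sec_mul, τ.2 c]

lemma rootPerm_be_inv (c : Bool) : rootPerm be⁻¹ c = !c := by
  have h := rootPerm_mul be⁻¹ be (!c)
  rw [inv_mul_cancel, rootPerm_one, rootPerm_be, Bool.not_not] at h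
  exact h.symm

lemma sec_be_inv (c : Bool) : sec be⁻¹ c = (sec be (!c))⁻¹ := by
  have h := sec_mul be⁻¹ be (!c)
  rw [inv_mul_cancel, sec_one, rootPerm_be, Bool.not_not] at h
  exact eq_inv_of_mul_eq_one_left h.symm

/-- The basilica group is self-replicating: β² has section α at both letters, α has section β at
`b`, and the conjugate of α by β has section β at `a`. -/
lemma exists_lift (c : Bool) {d : autInf} (hd : d ∈ basilica) :
    ∃ e : rootStab, e.1 ∈ basilica ∧ secHom c e = d := by
  have key : basilica ≤ (basilica.subgroupOf rootStab).map (secHom c) := by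
    refine (Subgroup.closure_le _).2 ?_
    rintro σ (rfl | rfl)
    · refine ⟨⟨be * be, fun c => by simp [rootPerm_mul]⟩, mul_mem be_mem be_mem, ?_⟩
      change sec (be * be) c = al
      rw [sec_mul, rootPerm_be]
      cases c
      · change sec be b * sec be a = al
        simp
      · change sec be a * sec be b = al
        simp
    · cases c
      · refine ⟨⟨be⁻¹ * al * be, fun c => by simp [rootPerm_mul, rootPerm_be_inv]⟩,
          mul_mem (mul_mem (inv_mem be_mem) al_mem) be_mem, ?_⟩
        change sec (be⁻¹ * al * be) a = be
        rw [sec_mul, sec_mul, rootPerm_be, rootPerm_al, sec_be_inv]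
        change (sec be a)⁻¹ * sec al b * sec be a = be
        simp
      · exact ⟨⟨al, rootPerm_al⟩, al_mem, sec_al_b⟩
  obtain ⟨e, he, h⟩ := key hd
  exact ⟨e, he, h⟩

/-- The elements `m` for which `(1, m)` is in the basilica group. -/
noncomputable def rigid : Subgroup autInf :=
  ((basilica.subgroupOf rootStab) ⊓ (secHom a).ker).map (secHom b)

lemma mem_rigid {m : autInf} : m ∈ rigid ↔
    ∃ e : rootStab, e.1 ∈ basilica ∧ sec e.1 a = 1 ∧ sec e.1 b = m :=
  ⟨fun ⟨e, he, h⟩ => ⟨e, he.1, he.2, h⟩, fun ⟨e, h1, h2, h3⟩ => ⟨e, ⟨h1, h2⟩, h3⟩⟩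

lemma be_mem_rigid : be ∈ rigid :=
  mem_rigid.2 ⟨⟨al, rootPerm_al⟩, al_mem, sec_al_a, sec_al_b⟩

/-- Conjugate by a lift of `d` through the section at `b`: having trivial section at `a` is a normal
condition in the stabilizer of level one. -/
lemma conj_mem_rigid {m d : autInf} (hm : m ∈ rigid) (hd : d ∈ basilica) :
    d * m * d⁻¹ ∈ rigid := by
  obtain ⟨e, he, rfl⟩ := exists_lift b hd
  obtain ⟨f, ⟨hf, hf'⟩, rfl⟩ := hm
  have he' : e ∈ basilica.subgroupOf rootStab := he
  refine ⟨e * f * e⁻¹, ⟨Subgroup.mul_mem _ (Subgroup.mul_mem _ he' hf)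
    (Subgroup.inv_mem _ he'), ?_⟩, by simp⟩
  exact (MonoidHom.normal_ker (secHom a)).conj_mem f hf' e

/-- The subgroup `rigid` contains β and is normalized by the basilica group, so powers of α
represent all its cosets. The homomorphism `sumQ` sends α to 1 and β to 0 and so reads off the
exponent. -/
lemma exists_rigid_mul_zpow {d : autInf} (hd : d ∈ basilica) :
    ∃ m ∈ rigid, ∃ k : ℤ, d = m * al ^ k ∧ sumQ d = k := by
  have hal := basilica_le_geomInf al_mem
  have hbe := basilica_le_geomInf be_mem
  induction hd using Subgroup.closure_induction_left with
  | one => exact ⟨1, one_mem _, 0, by simp, by simp⟩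
  | mul_left x hx y hy ih =>
    obtain ⟨m, hm, k, rfl, hk⟩ := ih
    rcases hx with rfl | rfl
    · refine ⟨al * m * al⁻¹, conj_mem_rigid hm al_mem, 1 + k, ?_, ?_⟩
      · rw [zpow_add, zpow_one]; group
      · rw [sumQ_mul_of_mem_geomInf hal, hk, sumQ_al]; push_cast; ring
    · refine ⟨be * m, mul_mem be_mem_rigid hm, k, by rw [mul_assoc], ?_⟩
      rw [sumQ_mul_of_mem_geomInf hbe, hk, sumQ_be, zero_add]
  | inv_mul_cancel x hx y hy ih =>
    obtain ⟨m, hm, k, rfl, hk⟩ := ih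
    rcases hx with rfl | rfl
    · refine ⟨al⁻¹ * m * al⁻¹⁻¹, conj_mem_rigid hm (inv_mem al_mem), -1 + k, ?_, ?_⟩
      · rw [zpow_add, zpow_neg_one]; group
      · rw [sumQ_mul_of_mem_geomInf (inv_mem hal), hk, sumQ_inv_of_mem_geomInf hal, sumQ_al]
        push_cast; ring
    · refine ⟨be⁻¹ * m, mul_mem (inv_mem be_mem_rigid) hm, k, by rw [mul_assoc], ?_⟩
      rw [sumQ_mul_of_mem_geomInf (inv_mem hbe), hk, sumQ_inv_of_mem_geomInf hbe, sumQ_be]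
      simp

/-- Since α = (1, β) and β² = (α, α), the element α^(2^(j+1)) acts as α^(2^j) on the trees above
`ba` and `bb`, and trivially above `a`. Each squaring thus gains two levels. -/
lemma al_pow_agree (j : ℕ) : AgreeUpTo (2 * j + 1) (al ^ 2 ^ j) 1 := by
  induction j with
  | zero =>
    intro w hw
    match w with
    | [] => simp
    | [c] => rw [pow_zero, pow_one, apply_cons]; simp
    | _ :: _ :: _ => simp at hw
  | succ j ih =>
    have hbe : ∀ c w, (be * be).1 (c :: w) = c :: al.1 w := fun c w => by
      cases c
      · exact (congrArg _ (be_a w)).trans (be_b w)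
      · exact (congrArg _ (be_b w)).trans (be_a _)
    have h1 : ∀ i c w, ((be * be) ^ i).1 (c :: w) = c :: (al ^ i).1 w := fun i c w => by
      induction i with
      | zero => rfl
      | succ i ih => rw [pow_succ', pow_succ', mul_apply (be * be), mul_apply al, ih, hbe]
    have h2 : ∀ i w, (al ^ i).1 (b :: w) = b :: (be ^ i).1 w := fun i w => by
      induction i with
      | zero => rfl
      | succ i ih => rw [pow_succ', pow_succ', mul_apply, mul_apply, ih, al_b]
    have h3 : ∀ i w, (al ^ i).1 (a :: w) = a :: w := fun i w => by
      induction i with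
      | zero => rfl
      | succ i ih => rw [pow_succ', mul_apply, ih, al_a]
    intro w hw
    match w with
    | [] => exact apply_nil _
    | false :: w => exact h3 _ w
    | [true] => rw [h2, apply_nil]; rfl
    | true :: c :: w =>
      rw [h2, pow_succ', pow_mul, pow_two, h1, ih w (by simp at hw; omega)]
      rfl

/-! ### Generation of the geometric group -/

/-- The congruences `P(σ,x) ≡ 1 (mod 2^j)`, `j = ⌊(n-m+1)/2⌋`, for all nodes `x` at levels
`m ≤ n`. -/
def GeomUpTo (n : ℕ) (σ : autInf) : Prop :=
  ∀ x : Word, x.length ≤ n → (2 : ℤ_[2]) ^ ((n - x.length + 1) / 2) ∣ P σ x - 1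

lemma CongrUpTo.geomUpTo {n : ℕ} {σ : autInf} (h : CongrUpTo n σ)
    (h1 : (2 : ℤ_[2]) ^ ((n + 1) / 2) ∣ P σ [] - 1) : GeomUpTo n σ := fun x hx => by
  have := (h x hx).add ((pow_dvd_aux x).trans h1)
  rwa [sub_add_sub_cancel] at this

lemma GeomUpTo.mul_left {n : ℕ} {σ τ : autInf} (h : GeomUpTo n σ) (hτ : τ ∈ geomInf) :
    GeomUpTo n (τ * σ) := fun x hx => by
  rw [P_mul (geomInf_le_MInf hτ), hτ, one_mul]
  exact h x hx

lemma GeomUpTo.sec {n : ℕ} {σ : autInf} (h : GeomUpTo (n + 1) σ) (c : Bool) :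
    GeomUpTo n (sec σ c) := fun x hx => by
  have := h (c :: x) (by simpa using hx)
  rwa [P_sec, ← Nat.add_sub_add_right n 1 x.length]

lemma zpow_agree_one {n : ℕ} {σ : autInf} (h : AgreeUpTo n σ 1) (k : ℤ) :
    AgreeUpTo n (σ ^ k) 1 := by
  rw [← restrict_eq_iff, map_zpow, restrict_eq_iff.2 h, map_one, one_zpow]

lemma two_pow_dvd_intCast {j : ℕ} {k : ℤ} : (2 : ℤ_[2]) ^ j ∣ (k : ℤ_[2]) ↔ (2 : ℤ) ^ j ∣ k := by
  have := PadicInt.pow_p_dvd_int_iff (p := 2) j k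
  exact_mod_cast this

lemma two_mul_dvd_cancel {x y : ℤ_[2]} (h : 2 * x ∣ 2 * y) : x ∣ y :=
  (mul_dvd_mul_iff_left two_ne_zero).1 h

lemma agreeUpTo_succ_of_rootStab {n : ℕ} {σ τ : autInf} (hσ : σ ∈ rootStab) (hτ : τ ∈ rootStab)
    (h : ∀ c, AgreeUpTo n (sec σ c) (sec τ c)) : AgreeUpTo (n + 1) σ τ := fun w hw => by
  cases w with
  | nil => simp
  | cons c w => rw [apply_cons, apply_cons, hσ c, hτ c, h c w (by simpa using hw)]

/-- Dividing by a lift makes the section at `a` trivial on `T_n`. The section at `b` then agrees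
with some `m * al ^ k`, `m` in `rigid`; the congruence for `P` at the root is exactly what forces
α^k to be trivial on `T_n`, and `(1, m)` lies in the basilica group. -/
lemma exists_basilica_agree_of_rootStab {n : ℕ}
    (ih : ∀ σ, GeomUpTo n σ → ∃ d ∈ basilica, AgreeUpTo n σ d)
    {σ : autInf} (hσ : GeomUpTo (n + 1) σ) (hs : σ ∈ rootStab) :
    ∃ d ∈ basilica, AgreeUpTo (n + 1) σ d := by
  obtain ⟨da, hda, hag⟩ := ih _ (hσ.sec a)
  obtain ⟨e, he, rfl⟩ := exists_lift a hda
  have heg := inv_mem (basilica_le_geomInf he)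
  let s : rootStab := ⟨σ, hs⟩
  have hgeom : GeomUpTo (n + 1) (e⁻¹ * s).1 := hσ.mul_left heg
  have hta : AgreeUpTo n (sec (e⁻¹ * s).1 a) 1 := by
    change AgreeUpTo n (secHom a (e⁻¹ * s)) 1
    rw [map_mul, map_inv, ← inv_mul_cancel (secHom a e)]
    exact (AgreeUpTo.refl _ _).mul hag
  obtain ⟨db, hdb, hbg⟩ := ih _ (hgeom.sec b)
  obtain ⟨m, hm, k, rfl, hk⟩ := exists_rigid_mul_zpow hdb
  -- At the root, `P - 1` is twice the difference of `sumQ` at the two sections. These are `0` and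
  -- `k` modulo 2^(n/2), and cancelling the 2 leaves the claim.
  have hdvd : (2 : ℤ_[2]) ^ (n / 2) ∣ k := by
    have h1 := hta.dvd_sumQ_sub
    have h2 := hbg.dvd_sumQ_sub
    have h3 := hgeom [] (by simp)
    have hp : par (e⁻¹ * s).1 [] = 0 := (par_eq_zero_iff_rootPerm _).2 (e⁻¹ * s).2
    rw [P_nil_eq, hp, List.length_nil, Nat.sub_zero,
      show (n + 1 + 1) / 2 = n / 2 + 1 by omega, pow_succ'] at h3
    have h4 : (2 : ℤ_[2]) ^ (n / 2) ∣ sumQ (sec (e⁻¹ * s).1 b) - sumQ (sec (e⁻¹ * s).1 a) := by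
      refine two_mul_dvd_cancel (h3.trans (dvd_of_eq ?_))
      ring
    rw [hk] at h2
    rw [sumQ_one] at h1
    have e : (k : ℤ_[2]) = (sumQ (sec (e⁻¹ * s).1 b) - sumQ (sec (e⁻¹ * s).1 a))
      - (sumQ (sec (e⁻¹ * s).1 b) - k) + (sumQ (sec (e⁻¹ * s).1 a) - 0) := by ring
    rw [e]
    exact (h4.sub h2).add h1
  obtain ⟨q, rfl⟩ := two_pow_dvd_intCast.1 hdvd
  have hal : AgreeUpTo n (al ^ ((2 : ℤ) ^ (n / 2) * q)) 1 := by
    rw [zpow_mul]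
    refine zpow_agree_one ?_ q
    have := (al_pow_agree (n / 2)).mono (show n ≤ 2 * (n / 2) + 1 by omega)
    exact_mod_cast this
  obtain ⟨f, hf, hfa, hfb⟩ := mem_rigid.1 hm
  refine ⟨e.1 * f.1, mul_mem he hf, ?_⟩
  have key : AgreeUpTo (n + 1) (e⁻¹ * s).1 f.1 := by
    refine agreeUpTo_succ_of_rootStab (e⁻¹ * s).2 f.2 fun c => ?_
    cases c
    · rw [show sec f.1 false = 1 from hfa]; exact hta
    · rw [show sec f.1 true = m from hfb]
      refine hbg.trans ?_
      have := (AgreeUpTo.refl n m).mul hal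
      rwa [mul_one] at this
  have h := (AgreeUpTo.refl (n + 1) e.1).mul key
  have e1 : e.1 * (e⁻¹ * s).1 = σ := by
    change e.1 * (e.1⁻¹ * σ) = σ
    group
  rwa [e1] at h

/-- Up to every level, the group cut out by `P = 1` is generated by `α` and `β`. -/
theorem exists_basilica_agree (n : ℕ) :
    ∀ σ, GeomUpTo n σ → ∃ d ∈ basilica, AgreeUpTo n σ d := by
  induction n with
  | zero =>
    refine fun σ _ => ⟨1, one_mem _, fun w hw => ?_⟩
    rw [List.length_eq_zero_iff.1 (Nat.le_zero.1 hw), apply_nil, apply_nil]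
  | succ n ih =>
    intro σ hσ
    rcases par_eq σ [] with hp | hp
    · exact exists_basilica_agree_of_rootStab ih hσ ((par_eq_zero_iff_rootPerm σ).1 hp)
    · have hbe := basilica_le_geomInf be_mem
      -- Multiplication by β reduces to the case where level one is fixed.
      obtain ⟨d, hd, h⟩ := exists_basilica_agree_of_rootStab ih (hσ.mul_left hbe)
        (fun c => by rw [rootPerm_mul, rootPerm_be]; simp [rootPerm, hp])
      refine ⟨be⁻¹ * d, mul_mem (inv_mem be_mem) hd, ?_⟩
      have := (AgreeUpTo.refl (n + 1) be⁻¹).mul h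
      rwa [inv_mul_cancel_left] at this

/-! ### Elements with prescribed multiplier -/

/-- The map underlying `ga`. -/
noncomputable def gaFun (m : ℕ) : Word → Word
  | [] => []
  | false :: w => a :: gaFun m w
  | true :: w => b :: (al ^ m).1 (gaFun m w)

lemma length_gaFun (m : ℕ) (w : Word) : (gaFun m w).length = w.length := by
  induction w with
  | nil => simp [gaFun]
  | cons c w ih =>
    cases c
    · simp [gaFun, ih]
    · rw [gaFun, List.length_cons, length_apply, ih, List.length_cons]

lemma gaFun_dropLast (m : ℕ) (w : Word) : gaFun m w.dropLast = (gaFun m w).dropLast := by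
  induction w with
  | nil => simp [gaFun]
  | cons c w ih =>
    have h : gaFun m w = [] ↔ w = [] := by
      rw [← List.length_eq_zero_iff, length_gaFun, List.length_eq_zero_iff]
    have h' : (al ^ m).1 (gaFun m w) = [] ↔ w = [] := by
      rw [← List.length_eq_zero_iff, length_apply, length_gaFun, List.length_eq_zero_iff]
    by_cases hw : w = []
    · subst hw
      cases c
      · simp [gaFun]
      · rw [gaFun, gaFun, apply_nil]; rfl
    · rw [List.dropLast_cons_of_ne_nil hw]
      cases c
      · rw [gaFun, gaFun, ih, List.dropLast_cons_of_ne_nil (by rwa [ne_eq, h])]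
      · rw [gaFun, gaFun, ih, List.dropLast_cons_of_ne_nil (by rwa [ne_eq, h']),
          ((al ^ m).2 (gaFun m w)).2]

lemma gaFun_injective (m : ℕ) : Function.Injective (gaFun m) := by
  intro v w
  induction v generalizing w with
  | nil =>
    intro h
    have := congrArg List.length h
    rw [length_gaFun, length_gaFun] at this
    exact (List.length_eq_zero_iff.1 this.symm).symm
  | cons c v ih =>
    cases w with
    | nil =>
      intro h
      have := congrArg List.length h
      simp [length_gaFun] at this
    | cons d w =>
      cases c <;> cases d <;> simp only [gaFun, List.cons.injEq, a, b, reduceCtorEq, true_and,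
        false_and, IsEmpty.forall_iff] <;> intro h
      · exact ih h
      · exact ih ((al ^ m).1.injective h)

/-- An automorphism `γ = (γ, α^m γ)`, which has `P(γ,x) = 1 + 2m` for all `x`. -/
noncomputable def ga (m : ℕ) : autInf :=
  ofInjective (gaFun m) (length_gaFun m) (gaFun_dropLast m) (gaFun_injective m)

lemma sec_ga_a (m : ℕ) : sec (ga m) a = ga m := sec_eq (d := a) fun w => by simp [ga, gaFun]

lemma sec_ga_b (m : ℕ) : sec (ga m) b = al ^ m * ga m :=
  sec_eq (d := b) fun w => by
    rw [mul_apply, ga, ofInjective_apply, ofInjective_apply, gaFun]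

lemma par_ga (m : ℕ) : par (ga m) [] = 0 := by simp [par, ga, gaFun]

/-- The two sections differ by the factor α^m, whose `sumQ` is `m`; this gives the value at the
root. Since α has multiplier 1, both sections have the same multipliers as γ, so the value spreads
to all nodes. -/
lemma P_ga (m : ℕ) (x : Word) : P (ga m) x = 1 + 2 * m := by
  have hal : al ^ m ∈ geomInf := pow_mem (basilica_le_geomInf al_mem) m
  induction x with
  | nil =>
    have h := sumQ_al_zpow m
    rw [zpow_natCast, Int.cast_natCast] at h
    rw [P_nil_eq, par_ga, sec_ga_a, sec_ga_b, sumQ_mul_of_mem_geomInf hal, h]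
    ring
  | cons c x ih =>
    rw [← P_sec]
    cases c
    · rw [show sec (ga m) false = _ from sec_ga_a m, ih]
    · rw [show sec (ga m) true = _ from sec_ga_b m, P_mul (geomInf_le_MInf hal), hal, ih, one_mul]

lemma ga_mem_MInf (m : ℕ) : ga m ∈ MInf := fun x => by rw [P_ga, P_ga]

/-! ### Squares of `2`-adic units -/

lemma two_dvd_or_two_dvd_sub_one (w : ℤ_[2]) : (2 : ℤ_[2]) ∣ w ∨ (2 : ℤ_[2]) ∣ w - 1 := by
  obtain ⟨n, hn, h⟩ := PadicInt.exists_mem_range (p := 2) w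
  rw [PadicInt.maximalIdeal_eq_span_p, Ideal.mem_span_singleton] at h
  interval_cases n
  · left; simpa using h
  · right; simpa using h

/-- Units congruent to 1 modulo 8 are squares. The approximate root is built bit by bit in the form
`1 + 2 * m` with `m` natural, because those are the multipliers of `ga m`. -/
lemma exists_sq_congr {z : ℤ_[2]} (hz : (2 : ℤ_[2]) ^ 3 ∣ z - 1) (k : ℕ) :
    ∃ m : ℕ, (2 : ℤ_[2]) ^ (k + 3) ∣ (1 + 2 * m) ^ 2 - z := by
  induction k with
  | zero =>
    refine ⟨0, ?_⟩
    rw [← dvd_neg]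
    simpa using hz
  | succ k ih =>
    obtain ⟨m, w, hw⟩ := ih
    rcases two_dvd_or_two_dvd_sub_one w with ⟨v, hv⟩ | ⟨v, hv⟩
    · refine ⟨m, v, ?_⟩
      rw [hw, hv]; ring
    -- This changes the square by 2^(k+3)(1+2m) + 2^(2k+4), an odd multiple of 2^(k+3), which
    -- cancels the odd error.
    · refine ⟨m + 2 ^ (k + 1), v + 1 + m + 2 ^ k, ?_⟩
      push_cast
      have e : (1 + 2 * ((m : ℤ_[2]) + 2 ^ (k + 1))) ^ 2 - z =
        ((1 + 2 * (m : ℤ_[2])) ^ 2 - z) + 2 ^ (k + 3) * (1 + 2 * m) + 2 ^ (2 * k + 4) := by ring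
      rw [e, hw, show w = 2 * v + 1 by linear_combination hv]
      ring

/-! ### Subgroups of index two -/

/-- By the Sylow theorems the subgroup `H`, of order a smaller power of 2, extends to one of half
the order of `G`. -/
lemma _root_.IsPGroup.exists_index_two_of_ne_top {G : Type*} [Group G] [Finite G]
    (hG : IsPGroup 2 G) {H : Subgroup G} (hH : H ≠ ⊤) : ∃ L : Subgroup G, L.index = 2 ∧ H ≤ L := by
  have : Fact (Nat.Prime 2) := ⟨Nat.prime_two⟩
  obtain ⟨N, hN⟩ := IsPGroup.iff_card.1 hG
  obtain ⟨M, hM⟩ := IsPGroup.iff_card.1 (hG.to_subgroup H)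
  have hlt : M < N := by
    have h1 : Nat.card H ≤ Nat.card G := H.card_le_card_group
    rw [hN, hM] at h1
    refine lt_of_le_of_ne ((Nat.pow_le_pow_iff_right (by norm_num)).1 h1) fun h => hH ?_
    exact H.eq_top_of_card_eq (by rw [hN, hM, h])
  obtain ⟨L, hL, hHL⟩ := Sylow.exists_subgroup_card_pow_prime_le 2
    (hN ▸ pow_dvd_pow 2 (Nat.sub_le N 1)) H hM (by omega)
  refine ⟨L, ?_, hHL⟩
  have h := L.card_mul_index
  rw [hL, hN, show N = N - 1 + 1 by omega, pow_succ, Nat.add_sub_cancel] at h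
  exact Nat.eq_of_mul_eq_mul_left (by positivity) h

instance (n : ℕ) : Finite (WordLE n) := List.finite_length_le Bool n

/-- An automorphism that fixes a node fixes or swaps its two children, so one more squaring fixes
them. It follows that `Aut(T_n)` is a 2-group. -/
lemma pow_two_pow_agree_one (σ : autInf) (n : ℕ) : AgreeUpTo n (σ ^ 2 ^ n) 1 := by
  induction n with
  | zero =>
    intro w hw
    rw [List.length_eq_zero_iff.1 (Nat.le_zero.1 hw), apply_nil, apply_nil]
  | succ n ih =>
    intro w hw
    rcases List.eq_nil_or_concat' w with rfl | ⟨v, d, rfl⟩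
    · rw [apply_nil, apply_nil]
    · have hv : (σ ^ 2 ^ n).1 v = v := ih v (by simpa using hw)
      have h := fun d => apply_concat (σ ^ 2 ^ n) v d
      rw [pow_succ, pow_mul, pow_two, mul_apply, h, hv, h, hv]
      rcases par_eq (σ ^ 2 ^ n) v with hp | hp <;> simp [hp]

lemma isPGroup_autFin (n : ℕ) : IsPGroup 2 (autFin n) := fun τ => by
  obtain ⟨σ, rfl⟩ := restrict_surjective n τ
  refine ⟨n, ?_⟩
  rw [← map_pow, restrict_eq_iff.2 (pow_two_pow_agree_one σ n), map_one]

/-! ### Invariants of order two -/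

/-- The parity at the root. -/
def sgnOne (σ : autInf) : ZMod 2 := par σ []

/-- The sum of the parities at level one. -/
def sgnTwo (σ : autInf) : ZMod 2 := ∑ c : Bool, (par σ [c] : ZMod 2)

lemma par_mul_cast (σ τ : autInf) (x : Word) :
    (par (σ * τ) x : ZMod 2) = par σ (τ.1 x) + par τ x := by
  rw [par_mul]
  rcases par_eq τ x with h | h <;> rcases par_eq σ (τ.1 x) with h' | h' <;> simp [h, h']; decide

lemma sgnOne_mul (σ τ : autInf) : sgnOne (σ * τ) = sgnOne σ + sgnOne τ := by
  rw [sgnOne, par_mul_cast, apply_nil]; rfl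

lemma apply_singleton (σ : autInf) (c : Bool) : σ.1 [c] = [rootPerm σ c] := by
  rw [apply_cons, apply_nil]

lemma sgnTwo_mul (σ τ : autInf) : sgnTwo (σ * τ) = sgnTwo σ + sgnTwo τ := by
  simp only [sgnTwo, par_mul_cast, Finset.sum_add_distrib, apply_singleton]
  congr 1
  simp only [rootPerm]
  split_ifs <;> simp [add_comm]

/-- The multiplier `P(σ, root)` modulo `8`. -/
noncomputable def multEight (σ : autInf) : (ZMod (2 ^ 3))ˣ :=
  Units.map (PadicInt.toZModPow 3).toMonoidHom (isUnit_P σ []).unit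

lemma coe_multEight (σ : autInf) : (multEight σ : ZMod (2 ^ 3)) = PadicInt.toZModPow 3 (P σ []) :=
  rfl

lemma multEight_mul {σ : autInf} (hσ : σ ∈ MInf) (τ : autInf) :
    multEight (σ * τ) = multEight σ * multEight τ := by
  ext
  rw [coe_multEight, P_mul hσ, map_mul]; rfl

lemma multEight_inv {σ : autInf} (hσ : σ ∈ MInf) : multEight σ⁻¹ = (multEight σ)⁻¹ := by
  refine eq_inv_of_mul_eq_one_right ?_
  rw [← multEight_mul hσ, mul_inv_cancel]
  ext
  rw [coe_multEight, P_one, map_one]; rfl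

lemma multEight_eq_one_iff (σ : autInf) : multEight σ = 1 ↔ (2 : ℤ_[2]) ^ 3 ∣ P σ [] - 1 := by
  rw [Units.ext_iff, coe_multEight, Units.val_one, ← sub_eq_zero, ← map_one (PadicInt.toZModPow 3),
    ← map_sub, ← RingHom.mem_ker, PadicInt.ker_toZModPow, Ideal.mem_span_singleton]
  rfl

lemma sgnOne_congr {n : ℕ} (hn : 1 ≤ n) {σ τ : autInf} (h : AgreeUpTo n σ τ) :
    sgnOne σ = sgnOne τ := by
  rw [sgnOne, sgnOne, h.par_eq (by rw [List.length_nil]; omega)]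

lemma sgnTwo_congr {n : ℕ} (hn : 2 ≤ n) {σ τ : autInf} (h : AgreeUpTo n σ τ) :
    sgnTwo σ = sgnTwo τ :=
  Finset.sum_congr rfl fun c _ => by rw [h.par_eq (by rw [List.length_singleton]; omega)]

@[simp] lemma sgnOne_al : sgnOne al = 0 := by simp [sgnOne]
@[simp] lemma sgnOne_be : sgnOne be = 1 := by simp [sgnOne]
@[simp] lemma sgnTwo_al : sgnTwo al = 1 := by
  simp only [sgnTwo, ← par_sec, Fintype.sum_bool]
  change ((par (sec al b) [] : ℕ) : ZMod 2) + ((par (sec al a) [] : ℕ) : ZMod 2) = 1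
  simp [par_one]
@[simp] lemma sgnTwo_be : sgnTwo be = 0 := by
  simp only [sgnTwo, ← par_sec, Fintype.sum_bool]
  change ((par (sec be b) [] : ℕ) : ZMod 2) + ((par (sec be a) [] : ℕ) : ZMod 2) = 0
  simp [par_one]

/-- Elements of `M_∞` with arbitrary invariants. -/
lemma exists_mem_MInf (i j : ZMod 2) (u : (ZMod (2 ^ 3))ˣ) :
    ∃ σ ∈ MInf, sgnOne σ = i ∧ sgnTwo σ = j ∧ multEight σ = u := by
  have hal := basilica_le_geomInf al_mem
  have hbe := basilica_le_geomInf be_mem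
  have h1 : ∀ σ ∈ geomInf, multEight σ = 1 := fun σ hσ => by
    ext; rw [coe_multEight, hσ, map_one]; rfl
  have hgen : ∃ τ ∈ geomInf, sgnOne τ = i ∧ sgnTwo τ = j := by
    have h01 : ∀ i : ZMod 2, i = 0 ∨ i = 1 := by decide
    rcases h01 i with rfl | rfl <;> rcases h01 j with rfl | rfl
    · exact ⟨1, one_mem _, by simp [sgnOne, par_one], by simp [sgnTwo, par_one]⟩
    · exact ⟨al, hal, by simp, by simp⟩
    · exact ⟨be, hbe, by simp, by simp⟩
    · exact ⟨al * be, mul_mem hal hbe, by simp [sgnOne_mul], by simp [sgnTwo_mul]⟩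
  obtain ⟨τ, hτ, hi, hj⟩ := hgen
  -- Every unit modulo 8 is odd, hence the multiplier of some `ga m`; both sign invariants vanish on
  -- `ga m`.
  have hu : ∀ u : (ZMod (2 ^ 3))ˣ, ∃ m : ℕ, (1 : ZMod (2 ^ 3)) + 2 * (m : ZMod (2 ^ 3)) =
      (u : ZMod (2 ^ 3)) := by
    have : ∀ u : ZMod 8, IsUnit u → ∃ m : ZMod 8, 1 + 2 * m = u := by decide
    intro u
    obtain ⟨m, hm⟩ := this u u.isUnit
    exact ⟨m.val, by rw [ZMod.natCast_zmod_val (n := 8) m]; exact hm⟩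
  obtain ⟨m, hm⟩ := hu u
  have g1 : sgnOne (ga m) = 0 := by simp [sgnOne, par_ga]
  have g2 : sgnTwo (ga m) = 0 := by
    have e : par (al ^ m) [] = 0 :=
      (par_eq_zero_iff_rootPerm _).2 (pow_mem (show al ∈ rootStab from rootPerm_al) m)
    simp only [sgnTwo, ← par_sec, Fintype.sum_bool]
    change ((par (sec (ga m) b) [] : ℕ) : ZMod 2) + ((par (sec (ga m) a) [] : ℕ) : ZMod 2) = 0
    rw [sec_ga_a, sec_ga_b, par_mul_cast, par_ga, apply_nil, e]
    simp
  refine ⟨τ * ga m, mul_mem (geomInf_le_MInf hτ) (ga_mem_MInf m), ?_, ?_, ?_⟩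
  · rw [sgnOne_mul, hi, g1, add_zero]
  · rw [sgnTwo_mul, hj, g2, add_zero]
  · rw [multEight_mul (geomInf_le_MInf hτ), h1 τ hτ, one_mul]
    ext
    rw [coe_multEight, P_ga, ← hm, map_add, map_mul, map_one, map_natCast, map_ofNat]

/-! ### A criterion for a subgroup of `M_n` to be everything -/

/-- The multiplier is approximately the square of that of some `ga m`. Dividing by the square of `ga
m` leaves multiplier 1 to the precision of `T_n`, where the basilica group is everything. Characters
of order two ignore the square. -/
lemma exists_agree_sq_mul {n : ℕ} {σ : autInf} (hσ : CongrUpTo n σ)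
    (h8 : (2 : ℤ_[2]) ^ 3 ∣ P σ [] - 1) :
    ∃ g ∈ MInf, ∃ d ∈ basilica, AgreeUpTo n σ (g * g * d) := by
  obtain ⟨m, hm⟩ := exists_sq_congr h8 n
  have hg := ga_mem_MInf m
  have hg2 := mul_mem hg hg
  set g := ga m
  have hτ : CongrUpTo n ((g * g)⁻¹ * σ) :=
    congrUpTo_mul (mem_MInf_iff.1 (inv_mem hg2) n) hσ
  have hP : P σ [] = (1 + 2 * m) ^ 2 * P ((g * g)⁻¹ * σ) [] := by
    have h := P_mul hg2 ((g * g)⁻¹ * σ) []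
    rw [mul_inv_cancel_left, P_mul hg, P_ga] at h
    rw [h]; ring
  have hunit : IsUnit ((1 + 2 * (m : ℤ_[2])) ^ 2) := by
    rw [← P_ga m []]
    exact (isUnit_P _ _).pow 2
  -- Dividing by the unit square keeps the precision, and 2^(n+3) exceeds what level `n` needs.
  have hd : (2 : ℤ_[2]) ^ ((n + 1) / 2) ∣ P ((g * g)⁻¹ * σ) [] - 1 := by
    rw [← hunit.dvd_mul_left, mul_sub, ← hP, mul_one, ← dvd_neg, neg_sub]
    exact (pow_dvd_pow _ (by omega)).trans hm
  obtain ⟨d, hd, h⟩ := exists_basilica_agree n _ (hτ.geomUpTo hd)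
  refine ⟨g, hg, d, hd, ?_⟩
  have := (AgreeUpTo.refl n (g * g)).mul h
  rwa [mul_inv_cancel_left] at this

lemma zmod_two_add_self (x : ZMod 2) : x + x = 0 := CharTwo.add_self_eq_zero x

/-- A Frattini argument: if `H` were proper, some character of order two of `M_n` would vanish on
`H`. Such a character is controlled by the three invariants, and `H` realizes all their values, so
it would be trivial. -/
theorem MFin_le_of_invariants {n : ℕ} {H : Subgroup (autFin n)} (hHM : H ≤ MFin n)
    (hH : ∀ (i j : ZMod 2) (u : (ZMod (2 ^ 3))ˣ), ∃ σ ∈ MInf, restrict n σ ∈ H ∧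
      sgnOne σ = i ∧ sgnTwo σ = j ∧ multEight σ = u) : MFin n ≤ H := by
  classical
  rw [← Subgroup.subgroupOf_eq_top]
  by_contra hne
  obtain ⟨L, hL, hHL⟩ := ((isPGroup_autFin n).to_subgroup (MFin n)).exists_index_two_of_ne_top hne
  -- The character with kernel `L`, read on extensions to `T_∞`. It is additive only on those that
  -- restrict into `M_n`; elsewhere its value is the default 1.
  let χ : autInf → ZMod 2 := fun σ => if restrict n σ ∈ L.map (MFin n).subtype then 0 else 1
  have hχ : ∀ {σ} (hσ : CongrUpTo n σ), restrict n σ ∈ L.map (MFin n).subtype ↔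
      (⟨restrict n σ, restrict_mem_MFin_iff.2 hσ⟩ : MFin n) ∈ L := fun {σ} hσ => by
    constructor
    · rintro ⟨y, hy, h⟩
      rwa [show (⟨restrict n σ, _⟩ : MFin n) = y from Subtype.ext h.symm]
    · exact fun h => ⟨_, h, rfl⟩
  have χ_mul : ∀ {σ τ}, CongrUpTo n σ → CongrUpTo n τ → χ (σ * τ) = χ σ + χ τ := by
    intro σ τ hσ hτ
    have h := L.mul_mem_iff_of_index_two hL (a := ⟨restrict n σ, restrict_mem_MFin_iff.2 hσ⟩)
      (b := ⟨restrict n τ, restrict_mem_MFin_iff.2 hτ⟩)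
    rw [← hχ hσ, ← hχ hτ] at h
    have h' : restrict n (σ * τ) ∈ L.map (MFin n).subtype ↔ _ :=
      (hχ (congrUpTo_mul hσ hτ)).trans h
    simp only [χ, h']
    by_cases h1 : restrict n σ ∈ L.map (MFin n).subtype <;>
      by_cases h2 : restrict n τ ∈ L.map (MFin n).subtype <;> simp [h1, h2]
    decide
  have χ_congr : ∀ {σ τ}, AgreeUpTo n σ τ → χ σ = χ τ := fun h => by
    simp only [χ, restrict_eq_iff.2 h]
  have χ_one : χ 1 = 0 := by simp only [χ, map_one, one_mem, if_true]
  have χ_H : ∀ {σ}, restrict n σ ∈ H → χ σ = 0 := fun {σ} h => by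
    refine if_pos ⟨⟨_, hHM h⟩, hHL ?_, rfl⟩
    exact h
  -- The correction by sign characters makes ψ vanish on both generators: α has signs (0, 1) and β
  -- has signs (1, 0).
  let ψ : autInf → ZMod 2 := fun σ => χ σ + χ be * sgnOne σ + χ al * sgnTwo σ
  have ψ_mul : ∀ {σ τ}, CongrUpTo n σ → CongrUpTo n τ → ψ (σ * τ) = ψ σ + ψ τ := by
    intro σ τ hσ hτ
    simp only [ψ, χ_mul hσ hτ, sgnOne_mul, sgnTwo_mul]
    ring
  -- For `n < 1` or `n < 2` the signs are not visible on `T_n`, but then β or α acts trivially there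
  -- and the coefficient of that sign is 0.
  have ψ_congr : ∀ {σ τ}, AgreeUpTo n σ τ → ψ σ = ψ τ := by
    intro σ τ h
    simp only [ψ, χ_congr h]
    have h1 : χ be * sgnOne σ = χ be * sgnOne τ := by
      by_cases hn : 1 ≤ n
      · rw [sgnOne_congr hn h]
      · have : χ be = 0 := by
          rw [χ_congr (τ := 1), χ_one]
          exact (pow_two_pow_agree_one be 0).mono (by omega)
        rw [this, zero_mul, zero_mul]
    have h2 : χ al * sgnTwo σ = χ al * sgnTwo τ := by
      by_cases hn : 2 ≤ n
      · rw [sgnTwo_congr hn h]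
      · have : χ al = 0 := by
          rw [χ_congr (τ := 1), χ_one]
          exact (al_pow_agree 0).mono (by omega)
        rw [this, zero_mul, zero_mul]
    rw [h1, h2]
  have hM : ∀ {σ}, σ ∈ MInf → CongrUpTo n σ := fun h => mem_MInf_iff.1 h n
  have hB : ∀ {σ}, σ ∈ basilica → CongrUpTo n σ := fun h =>
    hM (geomInf_le_MInf (basilica_le_geomInf h))
  have ψ_one : ψ 1 = 0 := by
    have := ψ_mul (congrUpTo_one n) (congrUpTo_one n)
    simpa using this
  have ψ_basilica : ∀ {σ}, σ ∈ basilica → ψ σ = 0 := by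
    intro σ hσ
    induction hσ using Subgroup.closure_induction with
    | mem x hx =>
      rcases hx with rfl | rfl
      · simp [ψ, zmod_two_add_self]
      · simp [ψ, zmod_two_add_self]
    | one => exact ψ_one
    | mul x y hx hy h1 h2 => rw [ψ_mul (hB hx) (hB hy), h1, h2, add_zero]
    | inv x hx h =>
      have := ψ_mul (hB hx) (hB (inv_mem hx))
      rw [mul_inv_cancel, ψ_one, h, zero_add] at this
      exact this.symm
  have ψ_eight : ∀ {σ}, CongrUpTo n σ → multEight σ = 1 → ψ σ = 0 := by
    intro σ hσ h8
    obtain ⟨g, hg, d, hd, h⟩ := exists_agree_sq_mul hσ ((multEight_eq_one_iff σ).1 h8)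
    rw [ψ_congr h, ψ_mul (hM (mul_mem hg hg)) (hB hd), ψ_mul (hM hg) (hM hg),
      ψ_basilica hd, zmod_two_add_self, add_zero]
  have χ_be : χ be = 0 := by
    obtain ⟨σ, hσ, h, h1, h2, h3⟩ := hH 1 0 1
    have := ψ_eight (hM hσ) h3
    simpa [ψ, χ_H h, h1, h2] using this
  have χ_al : χ al = 0 := by
    obtain ⟨σ, hσ, h, h1, h2, h3⟩ := hH 0 1 1
    have := ψ_eight (hM hσ) h3
    simpa [ψ, χ_H h, h1, h2] using this
  have hL_top : L = ⊤ := by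
    rw [eq_top_iff]
    rintro ⟨τ, hτ⟩ -
    obtain ⟨σ, rfl⟩ := restrict_surjective n τ
    have hσ := restrict_mem_MFin_iff.1 hτ
    -- With χ zero on α and β, ψ equals χ. An element of `H` with the same multiplier modulo 8 moves
    -- σ into the region where ψ vanishes.
    obtain ⟨ρ, hρ, h, -, -, h3⟩ := hH 0 0 (multEight σ)
    have h8 : multEight (ρ⁻¹ * σ) = 1 := by
      rw [multEight_mul (inv_mem hρ), multEight_inv hρ, h3, inv_mul_cancel]
    have h0 := ψ_eight (congrUpTo_mul (hM (inv_mem hρ)) hσ) h8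
    have h1 := ψ_mul (hM hρ) (congrUpTo_mul (hM (inv_mem hρ)) hσ)
    rw [mul_inv_cancel_left, h0, add_zero] at h1
    simp only [ψ, χ_be, χ_al, zero_mul, add_zero, χ_H h] at h1
    exact (hχ hσ).1 (of_not_not fun hcon => one_ne_zero ((if_neg hcon).symm.trans h1))
  rw [hL_top, Subgroup.index_top] at hL
  omega

/-! ### Automorphisms with prescribed parities -/

/-- The map of words with parities `p`. -/
def portraitFun : (Word → Bool) → Word → Word
  | _, [] => []
  | p, c :: w => xor c (p []) :: portraitFun (fun v => p (c :: v)) w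

lemma length_portraitFun (p : Word → Bool) (w : Word) : (portraitFun p w).length = w.length := by
  induction w generalizing p with
  | nil => rfl
  | cons c w ih => simp [portraitFun, ih]

lemma portraitFun_concat (p : Word → Bool) (w : Word) (c : Bool) :
    portraitFun p (w ++ [c]) = portraitFun p w ++ [xor c (p w)] := by
  induction w generalizing p with
  | nil => rfl
  | cons d w ih => simp [portraitFun, ih]

lemma portraitFun_injective (p : Word → Bool) : Function.Injective (portraitFun p) := by
  intro v w
  induction v generalizing p w with
  | nil =>
    intro h
    have := congrArg List.length h
    rw [length_portraitFun, length_portraitFun] at this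
    exact (List.length_eq_zero_iff.1 this.symm).symm
  | cons c v ih =>
    cases w with
    | nil =>
      intro h
      have := congrArg List.length h
      simp [length_portraitFun] at this
    | cons d w =>
      intro h
      simp only [portraitFun, List.cons.injEq, Bool.xor_left_inj] at h
      obtain ⟨rfl, h⟩ := h
      rw [ih _ h]

/-- The automorphism with parities `p`. -/
noncomputable def ofPortrait (p : Word → Bool) : autInf :=
  ofInjective (portraitFun p) (length_portraitFun p) (fun w => by
    rcases List.eq_nil_or_concat' w with rfl | ⟨v, d, rfl⟩
    · rfl
    · rw [portraitFun_concat, List.dropLast_concat, List.dropLast_concat])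
    (portraitFun_injective p)

lemma par_ofPortrait (p : Word → Bool) (w : Word) : par (ofPortrait p) w = (p w).toNat := by
  unfold par
  rw [ofPortrait, ofInjective_apply, ofInjective_apply, portraitFun_concat]
  cases p w <;> simp [a]

lemma agreeUpTo_of_par_eq {n : ℕ} {σ τ : autInf}
    (h : ∀ w : Word, w.length < n → par σ w = par τ w) :
    AgreeUpTo n σ τ := by
  intro w
  induction w using List.reverseRecOn with
  | nil => simp
  | append_singleton w c ih =>
    intro hw
    rw [List.length_append, List.length_singleton] at hw
    rw [apply_concat, apply_concat, ih (by omega), h w (by omega)]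

/-! ### The order of `M_5` -/

/-- The residue of `(P(σ,x) - 1) / 2` modulo `2` is that of this number. -/
def theta (σ : autInf) (x : Word) : ℕ := par σ x + ∑ c : Bool, ∑ t : Bool, par σ (x ++ [c, t])

/-- Modulo 4, (-1)^p is 1 + 2p for p in {0, 1}, signs in front of even terms do not matter, and `Q`
is needed only modulo 2, where it is the parity. -/
lemma four_dvd_P_sub (σ : autInf) (x : Word) : (4 : ℤ_[2]) ∣ P σ x - (1 + 2 * theta σ x) := by
  have h : ∀ y, ∃ z, Q σ y = par σ y + 2 * z := fun y => ⟨_, Q_next σ y⟩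
  obtain ⟨z₁, h₁⟩ := h (x ++ [a, a])
  obtain ⟨z₂, h₂⟩ := h (x ++ [a, b])
  obtain ⟨z₃, h₃⟩ := h (x ++ [b, a])
  obtain ⟨z₄, h₄⟩ := h (x ++ [b, b])
  have hp : ∃ z : ℤ_[2], (-1) ^ par σ x = 1 + 2 * (par σ x : ℤ_[2]) + 4 * z := by
    rcases par_eq σ x with h | h
    · exact ⟨0, by simp [h]⟩
    · exact ⟨-1, by rw [h]; norm_num⟩
  obtain ⟨z, hz⟩ := hp
  refine ⟨z + z₃ + z₄ - z₁ - z₂ - par σ (x ++ [a, a]) - par σ (x ++ [a, b]), ?_⟩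
  simp only [P, theta, Fintype.sum_bool]
  change (-1) ^ par σ x + 2 * (Q σ (x ++ [b, b]) + Q σ (x ++ [b, a])) -
    2 * (Q σ (x ++ [a, b]) + Q σ (x ++ [a, a])) - (1 + 2 * ((par σ x + ((par σ (x ++ [b, b]) +
      par σ (x ++ [b, a])) + (par σ (x ++ [a, b]) + par σ (x ++ [a, a]))) : ℕ) : ℤ_[2])) = _
  rw [h₁, h₂, h₃, h₄, hz]
  push_cast
  ring

lemma two_dvd_natCast_sub_iff (m n : ℕ) :
    (2 : ℤ_[2]) ∣ (m : ℤ_[2]) - n ↔ (m : ZMod 2) = n := by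
  have h := two_pow_dvd_intCast (j := 1) (k := (m : ℤ) - n)
  rw [pow_one, pow_one] at h
  push_cast at h
  have h2 := ZMod.intCast_zmod_eq_zero_iff_dvd ((m : ℤ) - n) 2
  push_cast at h2
  rw [h, ← sub_eq_zero, h2]

lemma four_dvd_P_sub_P_iff (σ : autInf) (x y : Word) :
    (2 : ℤ_[2]) ^ 2 ∣ P σ x - P σ y ↔ (theta σ x : ZMod 2) = theta σ y := by
  have e4 : (2 : ℤ_[2]) ^ 2 = 4 := by norm_num
  have e : P σ x - P σ y = ((P σ x - (1 + 2 * theta σ x)) - (P σ y - (1 + 2 * theta σ y)))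
    + 2 * ((theta σ x : ℤ_[2]) - theta σ y) := by ring
  rw [← two_dvd_natCast_sub_iff, e, e4,
    dvd_add_right ((four_dvd_P_sub σ x).sub (four_dvd_P_sub σ y)),
    show (4 : ℤ_[2]) = 2 * 2 by norm_num, mul_dvd_mul_iff_left two_ne_zero]

lemma two_dvd_P_sub (σ : autInf) (x y : Word) : (2 : ℤ_[2]) ∣ P σ x - P σ y := by
  have h : ∀ x, (2 : ℤ_[2]) ∣ P σ x - 1 := fun x => by
    obtain ⟨z, hz⟩ := four_dvd_P_sub σ x
    exact ⟨2 * z + theta σ x, by linear_combination hz⟩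
  have := (h x).sub (h y)
  rwa [sub_sub_sub_cancel_right] at this

/-- The words of length less than `n`. -/
def wordsLT : ℕ → Finset Word
  | 0 => ∅
  | n + 1 => insert [] ((wordsLT n).image (a :: ·) ∪ (wordsLT n).image (b :: ·))

lemma mem_wordsLT {n : ℕ} {w : Word} : w ∈ wordsLT n ↔ w.length < n := by
  induction n generalizing w with
  | zero => simp [wordsLT]
  | succ n ih =>
    cases w with
    | nil => simp [wordsLT]
    | cons c w => cases c <;> simp [wordsLT, ih, a, b]

/-- The nodes at levels one and two. -/
def lowWords : Finset Word := (wordsLT 3).erase []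

/-- The nodes of `T_4` at which parities of elements of `M_5` can be prescribed. -/
def freeWords : Finset Word := wordsLT 5 \ lowWords.image (· ++ [b, b])

/-- There are 31 nodes below level 5, minus one node `xbb` for each of the six nodes `x` at levels
one and two. -/
lemma card_freeWords : freeWords.card = 25 := by decide +kernel

lemma lowWords_spec : ∀ x ∈ lowWords, x ∈ freeWords ∧ x ++ [a, a] ∈ freeWords ∧
    x ++ [a, b] ∈ freeWords ∧ x ++ [b, a] ∈ freeWords ∧ x ++ [b, b] ∉ freeWords := by
  decide +kernel

lemma nil_mem_freeWords : ([] : Word) ∈ freeWords ∧ [a, a] ∈ freeWords ∧ [a, b] ∈ freeWords ∧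
    [b, a] ∈ freeWords ∧ [b, b] ∈ freeWords := by
  decide +kernel

lemma theta_cast (σ : autInf) (x : Word) : (theta σ x : ZMod 2) =
    par σ x + (par σ (x ++ [b, b]) + par σ (x ++ [b, a]) +
      (par σ (x ++ [a, b]) + par σ (x ++ [a, a]))) := by
  simp only [theta, Fintype.sum_bool]
  push_cast
  rfl

/-- The exponent ⌊(6-m)/2⌋ is 2 at levels 1 and 2. From level 3 on it is at most 1, and the
condition is automatic because `P` is odd; at the root it is vacuous. -/
lemma congrUpTo_five_iff (σ : autInf) :
    CongrUpTo 5 σ ↔ ∀ x ∈ lowWords, (theta σ x : ZMod 2) = theta σ [] := by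
  have hlow : ∀ x, x ∈ lowWords ↔ x.length = 1 ∨ x.length = 2 := fun x => by
    rw [lowWords, Finset.mem_erase, mem_wordsLT, ← List.length_pos_iff_ne_nil]
    omega
  constructor
  · intro h x hx
    rw [hlow] at hx
    have := h x (by omega)
    rw [show (5 - x.length + 1) / 2 = 2 by omega] at this
    exact (four_dvd_P_sub_P_iff σ x []).1 this
  · intro h x hx
    by_cases h0 : x = []
    · subst h0
      rw [sub_self]
      exact dvd_zero _
    · have := List.length_pos_iff_ne_nil.2 h0
      by_cases h2 : x.length ≤ 2
      · rw [show (5 - x.length + 1) / 2 = 2 by omega]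
        exact (four_dvd_P_sub_P_iff σ x []).2 (h x ((hlow x).2 (by omega)))
      · exact (pow_dvd_pow 2 (show (5 - x.length + 1) / 2 ≤ 1 by omega)).trans
          (by rw [pow_one]; exact two_dvd_P_sub σ x [])

lemma par_eq_of_cast_eq {σ τ : autInf} {x y : Word} (h : (par σ x : ZMod 2) = par τ y) :
    par σ x = par τ y := by
  rcases par_eq σ x with h1 | h1 <;> rcases par_eq τ y with h2 | h2 <;> simp_all

/-- The six conditions are linear over `ZMod 2` in the parities, and the one at `x` can be solved
for the parity at `xbb`. All other parities that occur, including those in `theta` at the root,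
belong to `freeWords`, so these 25 can be chosen freely. -/
theorem card_MFin_five : Nat.card (MFin 5) = 2 ^ 25 := by
  choose ext hext using restrict_surjective 5
  let F : MFin 5 → (freeWords → ZMod 2) := fun τ w => par (ext τ.1) w.1
  have hmem : ∀ τ : MFin 5, ∀ x ∈ lowWords,
      (theta (ext τ.1) x : ZMod 2) = theta (ext τ.1) [] := fun τ =>
    (congrUpTo_five_iff _).1 (restrict_mem_MFin_iff.1 (by rw [hext]; exact τ.2))
  obtain ⟨n0, n1, n2, n3, n4⟩ := nil_mem_freeWords
  have hinj : Function.Injective F := by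
    intro τ τ' h
    have hF : ∀ w ∈ freeWords, (par (ext τ.1) w : ZMod 2) = par (ext τ'.1) w :=
      fun w hw => congrFun h ⟨w, hw⟩
    suffices AgreeUpTo 5 (ext τ.1) (ext τ'.1) from
      Subtype.ext (by rw [← hext τ.1, ← hext τ'.1, restrict_eq_iff.2 this])
    refine agreeUpTo_of_par_eq fun w hw => par_eq_of_cast_eq ?_
    by_cases hwF : w ∈ freeWords
    · exact hF w hwF
    · have : w ∈ lowWords.image (· ++ [b, b]) := by
        by_contra hcon
        exact hwF (Finset.mem_sdiff.2 ⟨mem_wordsLT.2 hw, hcon⟩)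
      obtain ⟨x, hx, rfl⟩ := Finset.mem_image.1 this
      obtain ⟨h0, h1, h2, h3, -⟩ := lowWords_spec x hx
      have e1 := hmem τ x hx
      have e2 := hmem τ' x hx
      rw [theta_cast, theta_cast, hF _ h0, hF _ h1, hF _ h2, hF _ h3] at e1
      simp only [List.nil_append, hF _ n0, hF _ n1, hF _ n2, hF _ n3, hF _ n4] at e1
      rw [theta_cast, theta_cast] at e2
      simp only [List.nil_append] at e2
      have := e1.trans e2.symm
      simpa using this
  have hsurj : Function.Surjective F := by
    intro f
    let g : Word → ZMod 2 := fun w => if h : w ∈ freeWords then f ⟨w, h⟩ else 0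
    let s : Word → ZMod 2 := fun x => g x + (g (x ++ [b, a]) + (g (x ++ [a, b]) + g (x ++ [a, a])))
    -- At `w = xbb` this is the solution of `theta x = theta []`: `s x` collects the other terms of
    -- `theta x`, and `s [] + g [b, b]` is `theta []`.
    let q : Word → ZMod 2 := fun w => if w ∈ freeWords then g w else
      s w.dropLast.dropLast + (s [] + g [b, b])
    let σ := ofPortrait fun w => decide (q w = 1)
    have hσ : ∀ w, (par σ w : ZMod 2) = q w := fun w => by
      rw [par_ofPortrait]
      generalize q w = z
      revert z
      decide
    have hF : ∀ w ∈ freeWords, (par σ w : ZMod 2) = g w := fun w hw => by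
      rw [hσ]; exact if_pos hw
    have hC : CongrUpTo 5 σ := by
      rw [congrUpTo_five_iff]
      intro x hx
      obtain ⟨h0, h1, h2, h3, h4⟩ := lowWords_spec x hx
      have hb : (par σ (x ++ [b, b]) : ZMod 2) = s x + (s [] + g [b, b]) := by
        rw [hσ]
        refine (if_neg h4).trans ?_
        have : (x ++ [b, b]).dropLast.dropLast = x := by
          rw [show x ++ [b, b] = x ++ [b] ++ [b] by simp, List.dropLast_concat,
            List.dropLast_concat]
        rw [this]
      rw [theta_cast, theta_cast, hb, hF _ h0, hF _ h1, hF _ h2, hF _ h3]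
      simp only [List.nil_append, hF _ n0, hF _ n1, hF _ n2, hF _ n3, hF _ n4, s]
      linear_combination zmod_two_add_self (g x) + zmod_two_add_self (g (x ++ [b, a])) +
        zmod_two_add_self (g (x ++ [a, b])) + zmod_two_add_self (g (x ++ [a, a]))
    refine ⟨⟨restrict 5 σ, restrict_mem_MFin_iff.2 hC⟩, funext fun w => ?_⟩
    have hw : w.1.length < 5 := mem_wordsLT.1 (Finset.mem_sdiff.1 w.2).1
    have hag : AgreeUpTo 5 (ext (restrict 5 σ)) σ := restrict_eq_iff.1 (hext _)
    change (par (ext (restrict 5 σ)) w.1 : ZMod 2) = f w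
    rw [hag.par_eq hw, hF _ w.2]
    exact dif_pos w.2
  rw [Nat.card_congr (Equiv.ofBijective F ⟨hinj, hsurj⟩), Nat.card_eq_fintype_card,
    Fintype.card_fun, ZMod.card, Fintype.card_coe, card_freeWords]

/-! ### Powers of roots of unity with `2`-adic exponents -/

section RootPow

variable {F : Type*} [Field F]

/-- The power `ζ_{2^m}^z` for a `2`-adic integer `z`. -/
noncomputable def rootPow (ζ : ℕ → F) (m : ℕ) (z : ℤ_[2]) : F :=
  ζ m ^ (PadicInt.toZModPow m z).val

lemma toZModPow_eq_iff {m : ℕ} {x y : ℤ_[2]} :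
    PadicInt.toZModPow m x = PadicInt.toZModPow m y ↔ (2 : ℤ_[2]) ^ m ∣ x - y := by
  rw [← sub_eq_zero, ← map_sub, ← RingHom.mem_ker, PadicInt.ker_toZModPow,
    Ideal.mem_span_singleton]
  rfl

lemma exists_natCast_congr (m : ℕ) (z : ℤ_[2]) : ∃ k : ℕ, (2 : ℤ_[2]) ^ m ∣ z - k :=
  ⟨(PadicInt.toZModPow m z).val, toZModPow_eq_iff.1 (by
    rw [map_natCast, ZMod.natCast_zmod_val])⟩

variable {ζ : ℕ → F} (hζ : ∀ m, IsPrimitiveRoot (ζ m) (2 ^ m))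

include hζ

lemma rootPow_eq {m k : ℕ} {z : ℤ_[2]} (h : (2 : ℤ_[2]) ^ m ∣ z - k) :
    rootPow ζ m z = ζ m ^ k := by
  rw [rootPow, toZModPow_eq_iff.2 h, map_natCast, ZMod.val_natCast,
    (hζ m).eq_orderOf, pow_mod_orderOf]

lemma rootPow_add (m : ℕ) (x y : ℤ_[2]) :
    rootPow ζ m (x + y) = rootPow ζ m x * rootPow ζ m y := by
  obtain ⟨k, hk⟩ := exists_natCast_congr m x
  obtain ⟨l, hl⟩ := exists_natCast_congr m y
  rw [rootPow_eq hζ hk, rootPow_eq hζ hl, ← pow_add, rootPow_eq hζ]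
  rw [Nat.cast_add, add_sub_add_comm]
  exact hk.add hl

lemma rootPow_zero (m : ℕ) : rootPow ζ m 0 = 1 := by
  rw [rootPow_eq hζ (k := 0) (by simp), pow_zero]

lemma rootPow_one (m : ℕ) : rootPow ζ m 1 = ζ m := by
  rw [rootPow_eq hζ (k := 1) (by simp), pow_one]

lemma rootPow_neg (m : ℕ) (x : ℤ_[2]) : rootPow ζ m (-x) = (rootPow ζ m x)⁻¹ := by
  refine eq_inv_of_mul_eq_one_left ?_
  rw [← rootPow_add hζ, neg_add_cancel, rootPow_zero hζ]

lemma rootPow_two_mul (hζ2 : ∀ m, ζ (m + 1) ^ 2 = ζ m) (m : ℕ) (x : ℤ_[2]) :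
    rootPow ζ (m + 1) (2 * x) = rootPow ζ m x := by
  obtain ⟨k, hk⟩ := exists_natCast_congr m x
  rw [rootPow_eq hζ hk, rootPow_eq hζ (k := 2 * k), pow_mul, hζ2]
  rw [Nat.cast_mul, Nat.cast_ofNat, ← mul_sub, pow_succ']
  exact mul_dvd_mul_left 2 hk

lemma rootPow_inj {m : ℕ} {x y : ℤ_[2]} :
    rootPow ζ m x = rootPow ζ m y ↔ (2 : ℤ_[2]) ^ m ∣ x - y := by
  rw [← toZModPow_eq_iff]
  refine ⟨fun h => ?_, fun h => by rw [rootPow, rootPow, h]⟩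
  exact ZMod.val_injective _ ((hζ m).pow_inj (ZMod.val_lt _) (ZMod.val_lt _) h)

end RootPow

/-! ### The action of the absolute Galois group on the tree -/

section Action

variable {K : Type*} [Field K] {Kbar : Type*} [Field Kbar] [Algebra K Kbar] {x₀ : K}

lemma Labeling.label_injective (ν : Labeling Kbar x₀) {v w : Word} (hl : v.length = w.length)
    (h : ν.label v = ν.label w) : v = w :=
  (ν.bijOn_level w.length).injOn hl rfl h

lemma Labeling.label_nil (ν : Labeling Kbar x₀) : ν.label [] = algebraMap K Kbar x₀ :=
  (ν.bijOn_level 0).mapsTo rfl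

lemma Labeling.autInf_ext (ν : Labeling Kbar x₀) {σ τ : autInf}
    (h : ∀ w, ν.label (σ.1 w) = ν.label (τ.1 w)) : σ = τ :=
  Basilica.autInf_ext fun w =>
    ν.label_injective (by rw [length_apply, length_apply]) (h w)

lemma map_mem_preimages (g : Kbar ≃ₐ[K] Kbar) {n : ℕ} {z : Kbar} (hz : z ∈ preimages Kbar x₀ n) :
    g z ∈ preimages Kbar x₀ n := by
  have hc : Function.Semiconj g (fun z : Kbar => z ^ 2 - 1) (fun z : Kbar => z ^ 2 - 1) :=
    fun z => by simp
  change _ = _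
  rw [← (hc.iterate_right n) z, show _ = _ from hz, g.commutes]

lemma Labeling.exists_label_eq (ν : Labeling Kbar x₀) (g : Kbar ≃ₐ[K] Kbar) (w : Word) :
    ∃ v : Word, v.length = w.length ∧ ν.label v = g (ν.label w) :=
  (ν.bijOn_level w.length).surjOn (map_mem_preimages g ((ν.bijOn_level w.length).mapsTo rfl))

/-- The tree automorphism by which a field automorphism acts on the labels. -/
noncomputable def Labeling.act (ν : Labeling Kbar x₀) (g : Kbar ≃ₐ[K] Kbar) : autInf :=
  ofInjective (fun w => (ν.exists_label_eq g w).choose)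
    (fun w => (ν.exists_label_eq g w).choose_spec.1)
    (fun w => by
      have h := fun w => (ν.exists_label_eq g w).choose_spec
      rcases List.eq_nil_or_concat' w with rfl | ⟨v, d, rfl⟩
      · have h0 := (h []).1
        have h1 := List.length_eq_zero_iff.1 (h0.trans List.length_nil)
        exact h1.trans (congrArg List.dropLast h1).symm
      · rw [List.dropLast_concat]
        have hvd := h (v ++ [d])
        generalize (ν.exists_label_eq g (v ++ [d])).choose = u at hvd ⊢
        have hne : u ≠ [] := by rintro rfl; simp at hvd
        refine ν.label_injective ?_ ?_
        · rw [(h v).1, List.length_dropLast, hvd.1]; simp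
        · rw [(h v).2, ← ν.map_parent v d, map_sub, map_pow, map_one, ← hvd.2,
            ← ν.map_parent u.dropLast (u.getLast hne), List.dropLast_append_getLast])
    (fun v w h => by
      have h1 := (ν.exists_label_eq g v).choose_spec
      have h2 := (ν.exists_label_eq g w).choose_spec
      simp only at h
      rw [h] at h1
      exact ν.label_injective (h1.1.symm.trans h2.1) (g.injective (h1.2.symm.trans h2.2)))

lemma Labeling.label_act (ν : Labeling Kbar x₀) (g : Kbar ≃ₐ[K] Kbar) (w : Word) :
    ν.label ((ν.act g).1 w) = g (ν.label w) := (ν.exists_label_eq g w).choose_spec.2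

/-! ### The action on roots of unity -/

/-- The product `∏_{s₁,…,sᵢ} [y s₁ a s₂ a ⋯ sᵢ a]`. -/
noncomputable def Labeling.zagProd (ν : Labeling Kbar x₀) (i : ℕ) (y : Word) : Kbar :=
  ∏ s : Fin i → Bool, ν.label (y ++ zag s)

lemma Labeling.zagProd_zero (ν : Labeling Kbar x₀) (y : Word) :
    ν.zagProd 0 y = ν.label y := by simp [zagProd, zag]

lemma Labeling.zagProd_succ (ν : Labeling Kbar x₀) (i : ℕ) (y : Word) :
    ν.zagProd (i + 1) y = ∏ t : Bool, ν.zagProd i (y ++ [t] ++ [a]) := by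
  have : ν.zagProd (i + 1) y =
      ∏ p : Bool × (Fin i → Bool), ν.label ((y ++ [p.1] ++ [a]) ++ zag p.2) := by
    refine (Fintype.prod_equiv (Fin.consEquiv fun _ => Bool) _ _ fun p => ?_).symm
    simp [zag, Fin.consEquiv, List.ofFn_succ]
  rw [this, Fintype.prod_prod_type]
  rfl

variable {ν : Labeling Kbar x₀} {ζ : ℕ → Kbar}
  (hζ : ∀ m, IsPrimitiveRoot (ζ m) (2 ^ m)) (hζ2 : ∀ m, ζ (m + 1) ^ 2 = ζ m)
  (hν : ν.Compatible ζ)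

include hζ hν

/-- A vanishing denominator would have inverse 0 by convention, making the quotient 0 instead of a
root of unity. -/
lemma zagProd_b_ne_zero (i : ℕ) (y : Word) : ν.zagProd i (y ++ [b]) ≠ 0 := by
  intro h0
  have h : ν.zagProd i (y ++ [a]) * (ν.zagProd i (y ++ [b]))⁻¹ = ζ (i + 1) := hν y i
  rw [h0, inv_zero, mul_zero] at h
  exact (hζ (i + 1)).ne_zero (by positivity) h.symm

lemma zagProd_a (i : ℕ) (y : Word) :
    ν.zagProd i (y ++ [a]) = ζ (i + 1) * ν.zagProd i (y ++ [b]) := by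
  have h : ν.zagProd i (y ++ [a]) * (ν.zagProd i (y ++ [b]))⁻¹ = ζ (i + 1) := hν y i
  rw [← h, inv_mul_cancel_right₀ (zagProd_b_ne_zero hζ hν i y)]

include hζ2

/-- Field automorphisms permute the factors up to switching some letters `a` to `b`. By
compatibility each switch costs a root of unity, and the recursion that adds up the costs is that of
`Q`. -/
lemma map_zagProd (g : Kbar ≃ₐ[K] Kbar) (i : ℕ) (y : Word) :
    g (ν.zagProd i y) = ν.zagProd i ((ν.act g).1 y) *
      rootPow ζ i (-∑ t : Bool, Q (ν.act g) (y ++ [t])) := by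
  induction i generalizing y with
  | zero =>
    have : rootPow ζ 0 (-∑ t : Bool, Q (ν.act g) (y ++ [t])) = 1 := by
      rw [rootPow_eq hζ (k := 0) (by simp), pow_zero]
    rw [ν.zagProd_zero, ν.zagProd_zero, ν.label_act, this, mul_one]
  | succ i ih =>
    set σ := ν.act g
    have step : ∀ t : Bool, g (ν.zagProd i (y ++ [t] ++ [a])) =
        ν.zagProd i (σ.1 (y ++ [t]) ++ [a]) * rootPow ζ (i + 1) (-Q σ (y ++ [t])) := by
      intro t
      have e : (∑ t' : Bool, Q σ (y ++ [t] ++ [a] ++ [t'])) =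
          ∑ t' : Bool, Q σ (y ++ [t] ++ [a, t']) := by simp
      have hQ : -Q σ (y ++ [t]) = -(par σ (y ++ [t]) : ℤ_[2]) +
          2 * (-∑ t' : Bool, Q σ (y ++ [t] ++ [a, t'])) := by rw [Q_next]; ring
      rw [ih, e, hQ, rootPow_add hζ, rootPow_two_mul hζ hζ2, apply_concat σ (y ++ [t]) a,
        ← mul_assoc]
      congr 1
      -- If the parity is 1, the product above the letter `b` is the one above `a` divided by ζ.
      rcases par_eq σ (y ++ [t]) with h | h
      · rw [h, if_pos rfl, Nat.cast_zero, neg_zero, rootPow_zero hζ, mul_one]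
      · rw [h, if_neg one_ne_zero, Nat.cast_one, rootPow_neg hζ, rootPow_one hζ, zagProd_a hζ hν,
          mul_comm (ζ (i + 1)), mul_inv_cancel_right₀ ((hζ (i + 1)).ne_zero (by positivity))]
        rfl
    have hperm : ∏ t : Bool, ν.zagProd i (σ.1 (y ++ [t]) ++ [a]) = ν.zagProd (i + 1) (σ.1 y) := by
      rw [ν.zagProd_succ]
      simp only [apply_concat σ y]
      split_ifs <;> simp [mul_comm]
    have hsum : rootPow ζ (i + 1) (-∑ t : Bool, Q σ (y ++ [t])) =
        ∏ t : Bool, rootPow ζ (i + 1) (-Q σ (y ++ [t])) := by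
      rw [Fintype.sum_bool, Fintype.prod_bool, neg_add, rootPow_add hζ]
    rw [ν.zagProd_succ, map_prod, Finset.prod_congr rfl fun t _ => step t,
      Finset.prod_mul_distrib, hperm, hsum]

/-- A field automorphism raises `ζ_{2^m}` to the power `P(σ,x)`, for every node `x`. -/
lemma map_root (g : Kbar ≃ₐ[K] Kbar) (i : ℕ) (x : Word) :
    g (ζ (i + 1)) = rootPow ζ (i + 1) (P (ν.act g) x) := by
  have ha := map_zagProd hζ hζ2 hν g i (x ++ [a])
  have hb := map_zagProd hζ hζ2 hν g i (x ++ [b])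
  -- The image of the relation (product above `xa`) = ζ·(product above `xb`) is compared with the
  -- same relation at σ(x). If σ switches the letters, numerator and denominator trade places, which
  -- yields the term (-1)^par of `P`.
  have hg := congrArg g (zagProd_a hζ hν i x)
  set σ := ν.act g
  have e : ∀ c, (∑ t : Bool, Q σ (x ++ [c] ++ [t])) = ∑ t : Bool, Q σ (x ++ [c, t]) := by simp
  rw [map_mul, ha, hb, e, e] at hg
  have hP : P σ x = (-1) ^ par σ x + 2 * (-∑ t : Bool, Q σ (x ++ [a, t])) +
      2 * -(-∑ t : Bool, Q σ (x ++ [b, t])) := by unfold P; ring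
  rw [hP, rootPow_add hζ, rootPow_add hζ, rootPow_two_mul hζ hζ2, rootPow_two_mul hζ hζ2,
    rootPow_neg hζ i (-_)]
  set u := rootPow ζ i (-∑ t : Bool, Q σ (x ++ [a, t]))
  set v := rootPow ζ i (-∑ t : Bool, Q σ (x ++ [b, t])) with hv
  have hv0 : v ≠ 0 := pow_ne_zero _ ((hζ i).ne_zero (by positivity))
  have hz0 := (hζ (i + 1)).ne_zero (by positivity)
  have hR := zagProd_b_ne_zero hζ hν i (σ.1 x)
  have ca := apply_concat σ x a
  have cb := apply_concat σ x b
  rcases par_eq σ x with h | h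
  · rw [h] at ca cb ⊢
    rw [if_pos rfl] at ca cb
    rw [ca, cb, zagProd_a hζ hν] at hg
    rw [pow_zero, rootPow_one hζ]
    field_simp
    refine mul_right_cancel₀ hR ?_
    linear_combination -hg
  · rw [h] at ca cb ⊢
    rw [if_neg one_ne_zero] at ca cb
    have ca' : σ.1 (x ++ [a]) = σ.1 x ++ [b] := ca
    have cb' : σ.1 (x ++ [b]) = σ.1 x ++ [a] := cb
    rw [ca', cb', zagProd_a hζ hν] at hg
    rw [pow_one, rootPow_neg hζ, rootPow_one hζ]
    field_simp
    refine mul_right_cancel₀ hR ?_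
    linear_combination -hg

/-- The Galois group acts on the tree through the arithmetic basilica group. -/
theorem act_mem_MInf (g : Kbar ≃ₐ[K] Kbar) : ν.act g ∈ MInf := fun x => by
  rw [← sub_eq_zero]
  -- `map_root` concerns the exponents `i + 1`, so divisibility by 2^k is deduced from that by
  -- 2^(k+1).
  refine eq_zero_of_forall_two_pow_dvd fun k => (pow_dvd_pow 2 k.le_succ).trans ?_
  rw [← rootPow_inj hζ, ← map_root hζ hζ2 hν, ← map_root hζ hζ2 hν]

lemma map_root_eq_iff (g h : Kbar ≃ₐ[K] Kbar) :
    g (ζ 3) = h (ζ 3) ↔ multEight (ν.act g) = multEight (ν.act h) := by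
  rw [map_root hζ hζ2 hν g 2 [], map_root hζ hζ2 hν h 2 [], rootPow_inj hζ, ← toZModPow_eq_iff,
    Units.ext_iff]
  rfl

omit hζ2

/-- The case `i = 0` of compatibility, since ζ₂ = -1. -/
lemma label_b (y : Word) : ν.label (y ++ [b]) = -ν.label (y ++ [a]) := by
  have h := zagProd_a hζ hν 0 y
  rw [ν.zagProd_zero, ν.zagProd_zero,
    (show IsPrimitiveRoot (ζ 1) 2 from hζ 1).eq_neg_one_of_two_right] at h
  rw [h]; ring

lemma label_concat_apply (σ : autInf) (y : Word) :
    ν.label (σ.1 (y ++ [a])) = (-1) ^ par σ y * ν.label (σ.1 y ++ [a]) := by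
  rw [apply_concat]
  rcases par_eq σ y with h | h
  · simp [h]
  · rw [h, if_neg one_ne_zero, show (!a) = b from rfl, label_b hζ hν]
    ring

/-- Because `[a]² = 1 + x₀`, the element `s` is `[a]` up to sign. -/
lemma map_sqrt_one {s : Kbar} (hs : s ^ 2 = algebraMap K Kbar (1 + x₀)) (g : Kbar ≃ₐ[K] Kbar) :
    g s = (-1) ^ par (ν.act g) [] * s := by
  have h1 : ν.label [a] ^ 2 = s ^ 2 := by
    have := ν.map_parent [] a
    rw [ν.label_nil, List.nil_append] at this
    rw [hs, map_add, map_one]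
    linear_combination this
  have h2 : g (ν.label [a]) = (-1) ^ par (ν.act g) [] * ν.label [a] := by
    have := label_concat_apply hζ hν (ν.act g) []
    rwa [List.nil_append, apply_nil, List.nil_append, ν.label_act] at this
  rcases sq_eq_sq_iff_eq_or_eq_neg.1 h1 with h | h
  · rwa [h] at h2
  · rw [h, map_neg] at h2
    linear_combination -h2

/-- Because `([aa][ba])² = (1 + [a])(1 - [a]) = -x₀`, the element `r` is `[aa][ba]` up to sign. -/
lemma map_sqrt_two {r : Kbar} (hr : r ^ 2 = algebraMap K Kbar (-x₀)) (g : Kbar ≃ₐ[K] Kbar) :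
    g r = (-1) ^ (par (ν.act g) [a] + par (ν.act g) [b]) * r := by
  set σ := ν.act g
  have hb : ν.label [b] = -ν.label [a] := label_b hζ hν []
  have h1 : (ν.label [a, a] * ν.label [b, a]) ^ 2 = r ^ 2 := by
    have e0 := ν.map_parent [] a
    have e1 : ν.label [a, a] ^ 2 - 1 = ν.label [a] := ν.map_parent [a] a
    have e2 : ν.label [b, a] ^ 2 - 1 = ν.label [b] := ν.map_parent [b] a
    rw [ν.label_nil, List.nil_append] at e0
    rw [hr, map_neg, mul_pow, ← e0, show ν.label [a, a] ^ 2 = 1 + ν.label [a] by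
      linear_combination e1, show ν.label [b, a] ^ 2 = 1 - ν.label [a] by
      linear_combination e2 + hb]
    ring
  have h2 : g (ν.label [a, a] * ν.label [b, a]) =
      (-1) ^ (par σ [a] + par σ [b]) * (ν.label [a, a] * ν.label [b, a]) := by
    have ea : ν.label (σ.1 [a, a]) = _ := label_concat_apply hζ hν σ [a]
    have eb : ν.label (σ.1 [b, a]) = _ := label_concat_apply hζ hν σ [b]
    have ec : ν.label (σ.1 [a] ++ [a]) * ν.label (σ.1 [b] ++ [a]) =
        ν.label [a, a] * ν.label [b, a] := by
      rw [apply_singleton, apply_singleton]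
      unfold rootPerm
      split_ifs
      · rfl
      · exact mul_comm _ _
    rw [map_mul, ← ν.label_act, ← ν.label_act, ea, eb, ← ec]
    ring
  rcases sq_eq_sq_iff_eq_or_eq_neg.1 h1 with h | h
  · rwa [h] at h2
  · rw [h, map_neg] at h2
    linear_combination -h2

end Action

/-! ### Normality and separability of the fields generated by preimages -/

section Fields

variable {K : Type*} [Field K] {Kbar : Type*} [Field Kbar] [Algebra K Kbar]

lemma eqOn_adjoin {S : Set Kbar} {g h : Kbar ≃ₐ[K] Kbar} (H : ∀ x ∈ S, g x = h x) {x : Kbar}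
    (hx : x ∈ IntermediateField.adjoin K S) : g x = h x := by
  induction hx using IntermediateField.adjoin_induction with
  | mem x hx => exact H x hx
  | algebraMap x => rw [g.commutes, h.commutes]
  | add x y _ _ hx hy => rw [map_add, map_add, hx, hy]
  | inv x _ hx => rw [map_inv₀, map_inv₀, hx]
  | mul x y _ _ hx hy => rw [map_mul, map_mul, hx, hy]

lemma normal_adjoin_of_forall_map_mem [Normal K Kbar] {S : Set Kbar}
    (h : ∀ g : Kbar ≃ₐ[K] Kbar, ∀ x ∈ S, g x ∈ IntermediateField.adjoin K S) :
    Normal K (IntermediateField.adjoin K S) := by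
  rw [IntermediateField.normal_iff_forall_map_le']
  intro g
  rw [IntermediateField.adjoin_map, IntermediateField.adjoin_le_iff]
  rintro _ ⟨x, hx, rfl⟩
  exact h g x hx

/-- Away from characteristic 2, X² - z² is separable for z ≠ 0, and an element separable over the
separable closure already lies in it. -/
lemma mem_separableClosure_of_sq_mem (hK : ringChar K ≠ 2) {z : Kbar}
    (hz : z ^ 2 ∈ separableClosure K Kbar) : z ∈ separableClosure K Kbar := by
  by_cases h0 : z = 0
  · rw [h0]; exact zero_mem _
  have h2 : ((2 : ℕ) : separableClosure K Kbar) ≠ 0 := by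
    have h : (2 : K) ≠ 0 := Ring.two_ne_zero hK
    have := (map_ne_zero (algebraMap K (separableClosure K Kbar))).2 h
    rwa [map_ofNat] at this
  let y : separableClosure K Kbar := ⟨z ^ 2, hz⟩
  have hy : y ≠ 0 := fun h => h0 (pow_eq_zero_iff two_ne_zero |>.1 (congrArg Subtype.val h))
  have hsep := Polynomial.separable_X_pow_sub_C y h2 hy
  have hmem : z ∈ separableClosure (separableClosure K Kbar) Kbar := by
    rw [mem_separableClosure_iff]
    refine hsep.of_dvd (minpoly.dvd _ _ ?_)
    simp [y]
  rw [separableClosure.separableClosure_eq_bot, IntermediateField.mem_bot] at hmem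
  obtain ⟨w, rfl⟩ := hmem
  exact w.2

lemma mem_separableClosure_of_algebraMap {z : Kbar} {x : K} (h : z = algebraMap K Kbar x) :
    z ∈ separableClosure K Kbar := h ▸ (separableClosure K Kbar).algebraMap_mem x

variable {x₀ : K}

lemma Labeling.label_mem_separableClosure (hK : ringChar K ≠ 2) (ν : Labeling Kbar x₀) (w : Word) :
    ν.label w ∈ separableClosure K Kbar := by
  induction w using List.reverseRecOn with
  | nil => exact mem_separableClosure_of_algebraMap ν.label_nil
  | append_singleton w c ih =>
    refine mem_separableClosure_of_sq_mem hK ?_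
    rw [show ν.label (w ++ [c]) ^ 2 = ν.label w + 1 by linear_combination ν.map_parent w c]
    exact add_mem ih (one_mem _)

lemma Labeling.fieldFin_eq (ν : Labeling Kbar x₀) (n : ℕ) :
    fieldFin Kbar x₀ n = IntermediateField.adjoin K (ν.label '' {w | w.length ≤ n}) := by
  refine le_antisymm ?_ ?_
  · rw [fieldFin, ← (ν.bijOn_level n).image_eq]
    exact IntermediateField.adjoin.mono _ _ _ (Set.image_mono fun w hw => le_of_eq hw)
  · rw [IntermediateField.adjoin_le_iff]
    rintro _ ⟨w, hw, rfl⟩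
    exact ν.mem_fieldFin ⟨w, hw⟩

lemma Labeling.fieldInf_eq (ν : Labeling Kbar x₀) :
    fieldInf Kbar x₀ = IntermediateField.adjoin K (Set.range ν.label) := by
  refine le_antisymm (iSup_le fun n => ?_) ?_
  · rw [ν.fieldFin_eq]
    exact IntermediateField.adjoin.mono _ _ _ (Set.image_subset_range _ _)
  · rw [IntermediateField.adjoin_le_iff]
    rintro _ ⟨w, rfl⟩
    exact ν.mem_fieldInf w

lemma normal_fieldFin [Normal K Kbar] (n : ℕ) :
    Normal K (fieldFin Kbar x₀ n) :=
  normal_adjoin_of_forall_map_mem fun g _ hx =>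
    IntermediateField.subset_adjoin _ _ (map_mem_preimages g hx)

lemma Labeling.normal_fieldInf [Normal K Kbar] (ν : Labeling Kbar x₀) :
    Normal K (fieldInf Kbar x₀) := by
  rw [ν.fieldInf_eq]
  refine normal_adjoin_of_forall_map_mem ?_
  rintro g _ ⟨w, rfl⟩
  rw [← ν.label_act]
  exact IntermediateField.subset_adjoin _ _ ⟨_, rfl⟩

lemma isGalois_of_le_separableClosure {E : IntermediateField K Kbar} [Normal K E]
    (h : E ≤ separableClosure K Kbar) : IsGalois K E where
  to_isSeparable := (le_separableClosure_iff K Kbar E).1 h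

lemma Labeling.fieldInf_le_separableClosure (hK : ringChar K ≠ 2) (ν : Labeling Kbar x₀) :
    fieldInf Kbar x₀ ≤ separableClosure K Kbar := by
  rw [ν.fieldInf_eq, IntermediateField.adjoin_le_iff]
  rintro _ ⟨w, rfl⟩
  exact ν.label_mem_separableClosure hK w

lemma Labeling.isGalois_fieldInf [Normal K Kbar] (hK : ringChar K ≠ 2) (ν : Labeling Kbar x₀) :
    IsGalois K (fieldInf Kbar x₀) :=
  have := ν.normal_fieldInf
  isGalois_of_le_separableClosure (ν.fieldInf_le_separableClosure hK)

lemma Labeling.isGalois_fieldFin [Normal K Kbar] (hK : ringChar K ≠ 2) (ν : Labeling Kbar x₀)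
    (n : ℕ) : IsGalois K (fieldFin Kbar x₀ n) :=
  have := normal_fieldFin (x₀ := x₀) (Kbar := Kbar) (K := K) n
  isGalois_of_le_separableClosure
    ((le_iSup (fieldFin Kbar x₀) n).trans (ν.fieldInf_le_separableClosure hK))

lemma Labeling.finiteDimensional_fieldFin [Normal K Kbar] (ν : Labeling Kbar x₀) (n : ℕ) :
    FiniteDimensional K (fieldFin Kbar x₀ n) := by
  have : Finite (preimages Kbar x₀ n) := by
    rw [← (ν.bijOn_level n).image_eq]
    exact ((List.finite_length_eq Bool n).image _).to_subtype
  exact IntermediateField.finiteDimensional_adjoin fun x _ => Normal.isIntegral ‹_› x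

lemma exists_restrict_eq (E : IntermediateField K Kbar) [Normal K E] (g : Kbar ≃ₐ[K] Kbar) :
    ∃ h : E ≃ₐ[K] E, ∀ x : E, (h x : Kbar) = g x :=
  ⟨g.restrictNormal E, fun x => g.restrictNormal_commutes E x⟩

lemma exists_lift_eq [Normal K Kbar] {E : IntermediateField K Kbar} (h : E ≃ₐ[K] E) :
    ∃ g : Kbar ≃ₐ[K] Kbar, ∀ x : E, g x = h x :=
  ⟨h.liftNormal Kbar, fun x => h.liftNormal_commutes Kbar x⟩

/-! ### The Galois groups as groups of tree automorphisms -/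

lemma Labeling.autFin_ext (ν : Labeling Kbar x₀) {n : ℕ} {σ τ : autFin n}
    (h : ∀ w, ν.label (σ.1 w).1 = ν.label (τ.1 w).1) : σ = τ :=
  Subtype.ext (Equiv.ext fun w => Subtype.ext
    (ν.label_injective ((σ.2 w).1.trans (τ.2 w).1.symm) (h w)))

variable [Normal K Kbar]

/-- A lift of a field automorphism to `Kbar`. -/
noncomputable def liftAut {E : IntermediateField K Kbar} (h : E ≃ₐ[K] E) : Kbar ≃ₐ[K] Kbar :=
  (exists_lift_eq h).choose

lemma liftAut_apply {E : IntermediateField K Kbar} (h : E ≃ₐ[K] E) (x : E) :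
    liftAut h x = h x := (exists_lift_eq h).choose_spec x

lemma autEquiv_ext {E : IntermediateField K Kbar} {S : Set Kbar}
    (hE : E = IntermediateField.adjoin K S) {h h' : E ≃ₐ[K] E}
    (H : ∀ x (hx : x ∈ E), x ∈ S → h ⟨x, hx⟩ = h' ⟨x, hx⟩) : h = h' := by
  refine AlgEquiv.ext fun x => Subtype.ext ?_
  rw [← liftAut_apply, ← liftAut_apply]
  have hx : (x : Kbar) ∈ IntermediateField.adjoin K S := hE ▸ x.2
  refine eqOn_adjoin (fun y hy => ?_) hx
  have hyE : y ∈ E := hE ▸ IntermediateField.subset_adjoin K S hy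
  exact (liftAut_apply h ⟨y, hyE⟩).trans
    ((congrArg Subtype.val (H y hyE hy)).trans (liftAut_apply h' ⟨y, hyE⟩).symm)

variable (ν : Labeling Kbar x₀)

lemma Labeling.label_liftAut_fin {n : ℕ} (h : fieldFin Kbar x₀ n ≃ₐ[K] fieldFin Kbar x₀ n)
    (w : WordLE n) :
    ν.label ((restrict n (ν.act (liftAut h))).1 w).1 = h (ν.nodeFin w) :=
  (ν.label_act _ _).trans (liftAut_apply h (ν.nodeFin w))

/-- The action of `Gal(K_n/K)` on `T_n`. -/
noncomputable def Labeling.galFin (n : ℕ) :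
    (fieldFin Kbar x₀ n ≃ₐ[K] fieldFin Kbar x₀ n) →* autFin n :=
  MonoidHom.mk' (fun h => restrict n (ν.act (liftAut h))) fun h h' => ν.autFin_ext fun w => by
    rw [ν.label_liftAut_fin]
    change _ = ν.label ((restrict n (ν.act (liftAut h))).1
      ((restrict n (ν.act (liftAut h'))).1 w)).1
    rw [ν.label_liftAut_fin, AlgEquiv.mul_apply]
    exact congrArg (fun z => (h z : Kbar)) (Subtype.ext (ν.label_liftAut_fin h' w).symm)

lemma Labeling.nodeFin_galFin {n : ℕ} (h : fieldFin Kbar x₀ n ≃ₐ[K] fieldFin Kbar x₀ n)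
    (w : WordLE n) : ν.nodeFin ((ν.galFin n h).1 w) = h (ν.nodeFin w) :=
  Subtype.ext (ν.label_liftAut_fin h w)

lemma Labeling.galFin_injective (n : ℕ) : Function.Injective (ν.galFin n) := fun h h' H => by
  refine autEquiv_ext (ν.fieldFin_eq n) ?_
  rintro _ hx ⟨w, hw, rfl⟩
  exact (ν.nodeFin_galFin h ⟨w, hw⟩).symm.trans (H ▸ ν.nodeFin_galFin h' ⟨w, hw⟩)

lemma Labeling.restrict_act_mem_range (n : ℕ) (g : Kbar ≃ₐ[K] Kbar) :
    restrict n (ν.act g) ∈ (ν.galFin n).range := by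
  have := normal_fieldFin (x₀ := x₀) (Kbar := Kbar) (K := K) n
  obtain ⟨h, hh⟩ := exists_restrict_eq (fieldFin Kbar x₀ n) g
  refine ⟨h, ν.autFin_ext fun w => (congrArg Subtype.val (ν.nodeFin_galFin h w)).trans ?_⟩
  exact (hh (ν.nodeFin w)).trans (ν.label_act g w.1).symm

/-- Distinct nodes on a level have distinct labels, so equivariance forces φ to be the natural
action `galFin`. The existence of φ is thus surjectivity onto `M_n`. -/
lemma Labeling.isoFin_iff {n : ℕ} (hle : (ν.galFin n).range ≤ MFin n) :
    IsoFin ν n ↔ MFin n ≤ (ν.galFin n).range := by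
  constructor
  · rintro ⟨φ, hφ⟩ τ hτ
    refine ⟨φ.symm ⟨τ, hτ⟩, ν.autFin_ext fun w => ?_⟩
    have h1 := ν.nodeFin_galFin (φ.symm ⟨τ, hτ⟩) w
    rw [hφ, φ.apply_symm_apply] at h1
    exact congrArg Subtype.val h1
  · intro h
    refine ⟨MulEquiv.ofBijective ((ν.galFin n).codRestrict (MFin n) fun g => hle ⟨g, rfl⟩)
      ⟨fun g g' hg => ν.galFin_injective n (congrArg Subtype.val hg), fun τ => ?_⟩,
      fun g w => (ν.nodeFin_galFin g w).symm⟩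
    obtain ⟨g, hg⟩ := h τ.2
    exact ⟨g, Subtype.ext hg⟩

lemma Labeling.card_range_galFin (hK : ringChar K ≠ 2) (n : ℕ) :
    Nat.card (ν.galFin n).range = Module.finrank K (fieldFin Kbar x₀ n) := by
  have := ν.isGalois_fieldFin hK n
  have := ν.finiteDimensional_fieldFin n
  rw [← IsGalois.card_aut_eq_finrank]
  exact (Nat.card_congr (MonoidHom.ofInjective (ν.galFin_injective n)).toEquiv).symm

lemma Labeling.label_liftAut_inf (h : fieldInf Kbar x₀ ≃ₐ[K] fieldInf Kbar x₀) (w : Word) :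
    ν.label ((ν.act (liftAut h)).1 w) = h (ν.nodeInf w) :=
  (ν.label_act _ _).trans (liftAut_apply h (ν.nodeInf w))

/-- The action of `Gal(K_∞/K)` on `T_∞`. -/
noncomputable def Labeling.galInf : (fieldInf Kbar x₀ ≃ₐ[K] fieldInf Kbar x₀) →* autInf :=
  MonoidHom.mk' (fun h => ν.act (liftAut h)) fun h h' => ν.autInf_ext fun w => by
    rw [ν.label_liftAut_inf, mul_apply, ν.label_liftAut_inf, AlgEquiv.mul_apply]
    exact congrArg (fun z => (h z : Kbar)) (Subtype.ext (ν.label_liftAut_inf h' w).symm)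

lemma Labeling.nodeInf_galInf (h : fieldInf Kbar x₀ ≃ₐ[K] fieldInf Kbar x₀) (w : Word) :
    ν.nodeInf ((ν.galInf h).1 w) = h (ν.nodeInf w) :=
  Subtype.ext (ν.label_liftAut_inf h w)

lemma Labeling.galInf_injective : Function.Injective ν.galInf := fun h h' H => by
  refine autEquiv_ext ν.fieldInf_eq ?_
  rintro _ hx ⟨w, rfl⟩
  exact (ν.nodeInf_galInf h w).symm.trans (H ▸ ν.nodeInf_galInf h' w)

lemma Labeling.isoInf_of_forall (hM : ∀ g, ν.galInf g ∈ MInf)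
    (h : ∀ σ ∈ MInf, ∃ g, ν.galInf g = σ) :
    IsoInf ν := by
  refine ⟨MulEquiv.ofBijective (ν.galInf.codRestrict MInf hM)
    ⟨fun g g' hg => ν.galInf_injective (congrArg Subtype.val hg), fun τ => ?_⟩,
    fun g w => (ν.nodeInf_galInf g w).symm⟩
  obtain ⟨g, hg⟩ := h τ.1 τ.2
  exact ⟨g, Subtype.ext hg⟩

lemma Labeling.exists_act_eq_of_isoInf (h : IsoInf ν) {σ : autInf} (hσ : σ ∈ MInf) :
    ∃ g : Kbar ≃ₐ[K] Kbar, ν.act g = σ := by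
  obtain ⟨φ, hφ⟩ := h
  refine ⟨liftAut (φ.symm ⟨σ, hσ⟩), ν.autInf_ext fun w => ?_⟩
  rw [ν.label_liftAut_inf, hφ, φ.apply_symm_apply]
  rfl

/-- Surjectivity on the infinite level follows from surjectivity on all finite levels. -/
lemma Labeling.exists_galInf_eq (hK : ringChar K ≠ 2) {σ : autInf}
    (h : ∀ n, ∃ g : Kbar ≃ₐ[K] Kbar, AgreeUpTo n (ν.act g) σ) : ∃ g, ν.galInf g = σ := by
  have := ν.isGalois_fieldInf hK
  -- The elements acting as σ on `T_n` form a decreasing sequence of nonempty closed sets in the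
  -- compact Krull topology; a common point acts as σ on `T_∞`.
  let A : ℕ → Set (fieldInf Kbar x₀ ≃ₐ[K] fieldInf Kbar x₀) := fun n =>
    {g | ∀ w : Word, w.length ≤ n → g (ν.nodeInf w) = ν.nodeInf (σ.1 w)}
  have hclosed : ∀ x y : fieldInf Kbar x₀,
      IsClosed {g : fieldInf Kbar x₀ ≃ₐ[K] fieldInf Kbar x₀ | g x = y} := by
    -- The set is empty or a left coset of the stabilizer of `x`, which is open and hence closed.
    intro x y
    by_cases hne : ∃ g : fieldInf Kbar x₀ ≃ₐ[K] fieldInf Kbar x₀, g x = y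
    · obtain ⟨g, rfl⟩ := hne
      have hst : IsClosed (MulAction.stabilizer (fieldInf Kbar x₀ ≃ₐ[K] fieldInf Kbar x₀) x :
          Set (fieldInf Kbar x₀ ≃ₐ[K] fieldInf Kbar x₀)) :=
        Subgroup.isClosed_of_isOpen _ (stabilizer_isOpen_of_isIntegral x)
      convert hst.preimage (continuous_const_mul g⁻¹) using 1
      ext h
      change h x = g x ↔ g.symm (h x) = x
      exact (g.symm_apply_eq).symm
    · convert isClosed_empty
      exact Set.eq_empty_of_forall_notMem fun g hg => hne ⟨g, hg⟩
  have hA : ∀ n, IsClosed (A n) := fun n => by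
    have : A n = ⋂ w : Word, ⋂ _ : w.length ≤ n,
        {g : fieldInf Kbar x₀ ≃ₐ[K] fieldInf Kbar x₀ | g (ν.nodeInf w) = ν.nodeInf (σ.1 w)} := by
      ext g; simp [A]
    rw [this]
    exact isClosed_iInter fun w => isClosed_iInter fun _ => hclosed _ _
  have hne : ∀ n, (A n).Nonempty := fun n => by
    obtain ⟨g, hg⟩ := h n
    obtain ⟨h, hh⟩ := exists_restrict_eq (fieldInf Kbar x₀) g
    refine ⟨h, fun w hw => Subtype.ext ?_⟩
    rw [hh]
    change g (ν.label w) = ν.label (σ.1 w)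
    rw [← ν.label_act, hg w hw]
  obtain ⟨g, hg⟩ := IsCompact.nonempty_iInter_of_sequence_nonempty_isCompact_isClosed A
    (fun n g hg w hw => hg w (hw.trans n.le_succ)) hne (hA 0).isCompact hA
  refine ⟨g, ν.autInf_ext fun w => ?_⟩
  have h1 := ν.nodeInf_galInf g w
  rw [Set.mem_iInter.1 hg w.length w le_rfl] at h1
  exact congrArg Subtype.val h1

end Fields

/-! ### The degree-16 field and the invariants of order two -/

section Sixteen

variable {K : Type*} [Field K] {Kbar : Type*} [Field Kbar] [Algebra K Kbar] {x₀ : K}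

lemma neg_one_pow_eq_iff {F : Type*} [Field F] (h : (-1 : F) ≠ 1) (m n : ℕ) :
    (-1 : F) ^ m = (-1) ^ n ↔ (m : ZMod 2) = n := by
  have key : ∀ m : ℕ, ((-1 : F) ^ m = 1 ∧ (m : ZMod 2) = 0) ∨
      ((-1 : F) ^ m = -1 ∧ (m : ZMod 2) = 1) := fun m => by
    rcases m.even_or_odd with hm | hm
    · exact Or.inl ⟨hm.neg_one_pow, (ZMod.natCast_eq_zero_iff_even).2 hm⟩
    · exact Or.inr ⟨hm.neg_one_pow, (ZMod.natCast_eq_one_iff_odd).2 hm⟩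
  have h01 : (0 : ZMod 2) ≠ 1 := by decide
  rcases key m with ⟨h1, h2⟩ | ⟨h1, h2⟩ <;> rcases key n with ⟨h3, h4⟩ | ⟨h3, h4⟩ <;>
    simp [h1, h2, h3, h4, h, h.symm]

/-- The degree of the field generated by `√(-x₀)`, `√(1+x₀)` and `ζ₈` is `16` if and only if the
invariants of order two take all values on the Galois group. -/
theorem finrank_adjoin_eq_sixteen_iff [Normal K Kbar] (hK : ringChar K ≠ 2) (h0 : x₀ ≠ 0)
    (h1 : x₀ ≠ -1) {ζ : ℕ → Kbar} (hζ : ∀ m, IsPrimitiveRoot (ζ m) (2 ^ m))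
    (hζ2 : ∀ m, ζ (m + 1) ^ 2 = ζ m) {ν : Labeling Kbar x₀} (hν : ν.Compatible ζ)
    {r s : Kbar} (hr : r ^ 2 = algebraMap K Kbar (-x₀)) (hs : s ^ 2 = algebraMap K Kbar (1 + x₀)) :
    Module.finrank K (IntermediateField.adjoin K {r, s, ζ 3}) = 16 ↔
      ∀ (i j : ZMod 2) (u : (ZMod (2 ^ 3))ˣ), ∃ g : Kbar ≃ₐ[K] Kbar,
        sgnOne (ν.act g) = i ∧ sgnTwo (ν.act g) = j ∧ multEight (ν.act g) = u := by
  set S : Set Kbar := {r, s, ζ 3}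
  have hr0 : r ≠ 0 := by
    rintro rfl
    rw [zero_pow two_ne_zero, eq_comm, map_eq_zero] at hr
    exact h0 (neg_eq_zero.1 hr)
  have hs0 : s ≠ 0 := by
    rintro rfl
    rw [zero_pow two_ne_zero, eq_comm, map_eq_zero] at hs
    exact h1 (by linear_combination hs)
  have hneg : (-1 : Kbar) ≠ 1 := fun h =>
    (show IsPrimitiveRoot (ζ 1) 2 from hζ 1).ne_one one_lt_two
      ((show IsPrimitiveRoot (ζ 1) 2 from hζ 1).eq_neg_one_of_two_right.trans h)
  have hrS : r ∈ S := by simp [S]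
  have hsS : s ∈ S := by simp [S]
  have hzS : ζ 3 ∈ S := by simp [S]
  have hsub := IntermediateField.subset_adjoin K S
  have hunit : ∀ k : ℕ, (-1 : Kbar) ^ k ∈ IntermediateField.adjoin K S := fun k =>
    pow_mem (neg_mem (one_mem _)) k
  have hnormal : Normal K (IntermediateField.adjoin K S) := by
    refine normal_adjoin_of_forall_map_mem ?_
    rintro g x (rfl | rfl | rfl)
    · rw [map_sqrt_two hζ hν hr]
      exact mul_mem (hunit _) (hsub hrS)
    · rw [map_sqrt_one hζ hν hs]
      exact mul_mem (hunit _) (hsub hsS)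
    · rw [map_root hζ hζ2 hν g 2 []]
      exact pow_mem (hsub hzS) _
  have hsep : IntermediateField.adjoin K S ≤ separableClosure K Kbar := by
    rw [IntermediateField.adjoin_le_iff]
    rintro x (rfl | rfl | rfl)
    · exact mem_separableClosure_of_sq_mem hK (mem_separableClosure_of_algebraMap hr)
    · exact mem_separableClosure_of_sq_mem hK (mem_separableClosure_of_algebraMap hs)
    · have hz0 : ζ 0 = 1 := by simpa using (hζ 0).pow_eq_one
      refine mem_separableClosure_of_sq_mem hK (hζ2 2 ▸ ?_)
      refine mem_separableClosure_of_sq_mem hK (hζ2 1 ▸ ?_)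
      refine mem_separableClosure_of_sq_mem hK (hζ2 0 ▸ ?_)
      rw [hz0]
      exact one_mem _
  have hgal := isGalois_of_le_separableClosure hsep
  have hfin : FiniteDimensional K (IntermediateField.adjoin K S) :=
    have : Finite S := (Set.toFinite _).to_subtype
    IntermediateField.finiteDimensional_adjoin fun x _ => Normal.isIntegral ‹_› x
  let code : (Kbar ≃ₐ[K] Kbar) → ZMod 2 × ZMod 2 × (ZMod (2 ^ 3))ˣ := fun g =>
    (sgnOne (ν.act g), sgnTwo (ν.act g), multEight (ν.act g))
  -- The code records exactly the action on the three generators. The Galois group of the adjoined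
  -- field therefore embeds into a set of 16 elements, and the degree is 16 if and only if the code
  -- is onto.
  have hcode : ∀ g g', code g = code g' ↔ g r = g' r ∧ g s = g' s ∧ g (ζ 3) = g' (ζ 3) := by
    intro g g'
    rw [map_sqrt_two hζ hν hr, map_sqrt_two hζ hν hr, map_sqrt_one hζ hν hs,
      map_sqrt_one hζ hν hs, map_root_eq_iff hζ hζ2 hν, mul_left_inj' hr0, mul_left_inj' hs0,
      neg_one_pow_eq_iff hneg, neg_one_pow_eq_iff hneg, Prod.ext_iff, Prod.ext_iff]
    simp only [code, sgnOne, sgnTwo, Fintype.sum_bool, Nat.cast_add]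
    rw [add_comm ((par (ν.act g) [a] : ℕ) : ZMod 2), add_comm ((par (ν.act g') [a] : ℕ) : ZMod 2)]
    exact and_left_comm
  let F : (IntermediateField.adjoin K S ≃ₐ[K] IntermediateField.adjoin K S) →
      ZMod 2 × ZMod 2 × (ZMod (2 ^ 3))ˣ := fun h => code (liftAut h)
  have hF : Function.Injective F := by
    intro h h' H
    obtain ⟨e1, e2, e3⟩ := (hcode _ _).1 H
    refine autEquiv_ext rfl fun x hx hxS => Subtype.ext ?_
    rw [← liftAut_apply, ← liftAut_apply]
    rcases hxS with rfl | rfl | rfl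
    exacts [e1, e2, e3]
  have hcard : Nat.card (ZMod 2 × ZMod 2 × (ZMod (2 ^ 3))ˣ) = 16 := by
    rw [Nat.card_prod, Nat.card_prod, Nat.card_zmod, Nat.card_eq_fintype_card,
      ZMod.card_units_eq_totient, Nat.totient_prime_pow Nat.prime_two (by norm_num)]
    norm_num
  have hrange : ∀ g, ∃ h, F h = code g := by
    intro g
    obtain ⟨h, hh⟩ := exists_restrict_eq (IntermediateField.adjoin K S) g
    refine ⟨h, (hcode _ _).2 ⟨?_, ?_, ?_⟩⟩
    · exact (liftAut_apply h ⟨r, hsub hrS⟩).trans (hh _)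
    · exact (liftAut_apply h ⟨s, hsub hsS⟩).trans (hh _)
    · exact (liftAut_apply h ⟨ζ 3, hsub hzS⟩).trans (hh _)
  rw [← IsGalois.card_aut_eq_finrank, ← hcard]
  constructor
  · intro h i j u
    have hbij := hF.bijective_of_nat_card_le h.ge
    obtain ⟨g, hg⟩ := hbij.2 (i, j, u)
    exact ⟨liftAut g, congrArg Prod.fst hg, congrArg (fun x => x.2.1) hg,
      congrArg (fun x => x.2.2) hg⟩
  · intro h
    refine Nat.card_congr (Equiv.ofBijective F ⟨hF, fun ⟨i, j, u⟩ => ?_⟩)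
    obtain ⟨g, rfl, rfl, rfl⟩ := h i j u
    exact hrange g

/-- Here 3 = ⌊(5+1)/2⌋, and 5 is the least level for which this exponent reaches 3. -/
lemma multEight_congr {σ τ : autInf} (h : AgreeUpTo 5 σ τ) : multEight σ = multEight τ := by
  rw [Units.ext_iff, coe_multEight, coe_multEight, toZModPow_eq_iff]
  exact h.dvd_P_sub []

end Sixteen

end Basilica

/-! ### The equivalence of the five conditions -/

open Basilica in
theorem mainTheorem1 {K : Type*} [Field K] (hK : ringChar K ≠ 2)
    {Kbar : Type*} [Field Kbar] [Algebra K Kbar] [IsAlgClosure K Kbar]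
    (x₀ : K) (h0 : x₀ ≠ 0) (h1 : x₀ ≠ -1)
    (ζ : ℕ → Kbar) (hζ : ∀ m, IsPrimitiveRoot (ζ m) (2 ^ m)) (hζ2 : ∀ m, ζ (m + 1) ^ 2 = ζ m)
    (ν : Basilica.Labeling Kbar x₀) (hν : ν.Compatible ζ)
    (r s : Kbar) (hr : r ^ 2 = algebraMap K Kbar (-x₀)) (hs : s ^ 2 = algebraMap K Kbar (1 + x₀)) :
    List.TFAE [
      Module.finrank K (IntermediateField.adjoin K {r, s, ζ 3}) = 16,
      Module.finrank K (Basilica.fieldFin Kbar x₀ 5) = 2 ^ 25,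
      Basilica.IsoFin ν 5,
      ∀ n : ℕ, 1 ≤ n → Basilica.IsoFin ν n,
      Basilica.IsoInf ν] := by
  have : Normal K Kbar := IsAlgClosure.normal K Kbar
  have hact : ∀ g : Kbar ≃ₐ[K] Kbar, ν.act g ∈ MInf := act_mem_MInf hζ hζ2 hν
  have hle : ∀ n, (ν.galFin n).range ≤ MFin n := by
    rintro n _ ⟨g, rfl⟩
    exact restrict_mem_MFin_iff.2 (mem_MInf_iff.1 (hact _) n)
  have h16 := finrank_adjoin_eq_sixteen_iff hK h0 h1 hζ hζ2 hν hr hs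
  have hagree : ∀ {n : ℕ}, IsoFin ν n → ∀ σ ∈ MInf,
      ∃ g : Kbar ≃ₐ[K] Kbar, AgreeUpTo n (ν.act g) σ := by
    intro n h σ hσ
    obtain ⟨g, hg⟩ := (ν.isoFin_iff (hle n)).1 h (restrict_mem_MFin_iff.2 (mem_MInf_iff.1 hσ n))
    exact ⟨liftAut g, restrict_eq_iff.1 hg⟩
  tfae_have 1 → 4 := fun h n _ => by
    refine (ν.isoFin_iff (hle n)).2 (MFin_le_of_invariants (hle n) fun i j u => ?_)
    obtain ⟨g, hg⟩ := h16.1 h i j u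
    exact ⟨ν.act g, hact g, ν.restrict_act_mem_range n g, hg⟩
  tfae_have 4 → 3 := fun h => h 5 (by norm_num)
  tfae_have 3 → 1 := fun h => h16.2 fun i j u => by
    obtain ⟨σ, hσ, rfl, rfl, rfl⟩ := exists_mem_MInf i j u
    obtain ⟨g, hg⟩ := hagree h σ hσ
    exact ⟨g, sgnOne_congr (by norm_num) hg, sgnTwo_congr (by norm_num) hg, multEight_congr hg⟩
  tfae_have 2 ↔ 3 := by
    -- The image of `G_5` has order the degree of `K_5` and lies in `M_5`, of order 2^25; equality
    -- of orders is equality of groups.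
    rw [ν.isoFin_iff (hle 5), ← ν.card_range_galFin hK 5, ← card_MFin_five]
    exact ⟨fun h => (Subgroup.eq_of_le_of_card_ge (hle 5) h.ge).ge, fun h => by
      rw [le_antisymm (hle 5) h]⟩
  tfae_have 4 → 5 := fun h => ν.isoInf_of_forall (fun g => hact _) fun σ hσ =>
    ν.exists_galInf_eq hK fun n => by
      -- Level `n + 1` is used because the hypothesis starts at level 1.
      obtain ⟨g, hg⟩ := hagree (h (n + 1) (by omega)) σ hσ
      exact ⟨g, hg.mono n.le_succ⟩
  tfae_have 5 → 1 := fun h => h16.2 fun i j u => by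
    obtain ⟨σ, hσ, rfl, rfl, rfl⟩ := exists_mem_MInf i j u
    obtain ⟨g, rfl⟩ := ν.exists_act_eq_of_isoInf h hσ
    exact ⟨g, rfl, rfl, rfl⟩
  tfae_finish
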